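/- Let $n\in\mathbb N$, let $P_1,G_0,W_{B,1},W_{B,0},W_{C,1},W_{C,0}\in\mathbb C^{n\times n}$ with $P_1$ Hermitian and invertible and with $\begin{bmatrix}W_{B,1}&W_{B,0}\end{bmatrix}$, $\begin{bmatrix}W_{C,1}&W_{C,0}\end{bmatrix}$ of full row rank. Let $\mathcal H:[0,1]\to\mathbb C^{n\times n}$ be such that $\mathcal H(\zeta)$ is Hermitian and positive definite for almost all $\zeta\in[0,1]$ and $\mathcal H,\mathcal H^{-1}\in L^\infty(0,1;\mathbb C^{n\times n})$. Suppose that $P_1\mathcal H(\zeta)=S^{-1}(\zeta)\Delta(\zeta)S(\zeta)$ for almost all $\zeta\in[0,1]$, where $\Delta(\zeta)$ is diagonal, $S(\zeta)$ is invertible for almost all $\zeta$, and $S,S^{-1},\Delta$ are continuously differentiable on $[0,1]$. Let $X=L^2(0,1;\mathbb C^n)$ with the energy norm $\|x\|:=\sqrt{\langle x,\mathcal Hx\rangle_{L^2}}$ (equivalent to the $L^2$-norm), and define $$Ax=\Bigl(P_1\frac{d}{d\zeta}+G_0\Bigr)(\mathcal Hx),\qquad \mathbf D(A)=\bigl\{x\in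 X : \mathcal Hx\in H^1(0,1;\mathbb C^n),\ W_{B,1}(\mathcal Hx)(1)+W_{B,0}(\mathcal Hx)(0)=0\bigr\},$$ $$Cx=W_{C,1}(\mathcal Hx)(1)+W_{C,0}(\mathcal Hx)(0),\qquad x\in\mathbf D(A).$$ Assume that the matrix $\mathcal W_{BC}=\begin{bmatrix}W_{B,1}&W_{B,0}\\W_{C,1}&W_{C,0}\end{bmatrix}$ is invertible, that $A$ generates an exponentially stable $C_0$-semigroup $(T(t))_{t\ge0}$ on $X$ (i.e. $\|T(t)\|\le Me^{-\omega t}$ for all $t\ge 0$, with some $M\ge1$, $\omega>0$), and that $A-(\mathrm{Re}\,G_0)\mathcal H$ with domain $\mathbf D(A)$, where $\mathrm{Re}\,G_0=\frac12(G_0+G_0^*)$, generates a strongly stable $C_0$-semigroup $(T_0(t))_{t\ge0}$ on $X$ (i.e. $\lim_{t\to\infty}\|T_0(t)x\|=0$ for every $x\in X$). Then the Hautus test is satisfied: there exists a constant $m>0$ such that for every $s\in\mathbb C$ with $\mathrm{Re}\,s<0$ and every $x\in\mathbf D(A)$, $$\|(sI-A)x\|^2+|\mathrm{Re}\,s|\,\|Cx\|^2\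 \ge\ m\,|\mathrm{Re}\,s|^2\,\|x\|^2 .$$ Moreover, the system is approximately observable in infinite time: $$\int_0^\infty\|CT(t)x_0\|^2\,dt>0\qquad\text{for all } x_0\in\mathbf D(A),\ x_0\ne0 .$$ -/

import Mathlib

open Set Filter Topology MeasureTheory
open scoped NNReal ENNReal ComplexOrder

noncomputable section

/-! ### Strongly continuous semigroups and observation systems -/

section Semigroups

/-- A `C₀`-semigroup `(T(t))_{t ≥ 0}` of bounded operators on the normed space `E`. -/
structure C0Semigroup (E : Type*) [NormedAddCommGroup E] [NormedSpace ℂ E] where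
  /-- the operator `T(t)`, for `t ≥ 0` -/
  op : ℝ≥0 → E →L[ℂ] E
  op_zero : op 0 = ContinuousLinearMap.id ℂ E
  op_add : ∀ s t, op (s + t) = (op s).comp (op t)
  strongly_continuous : ∀ x, Tendsto (fun t => op t x) (𝓝 0) (𝓝 x)

namespace C0Semigroup

variable {E : Type*} [NormedAddCommGroup E] [NormedSpace ℂ E] (T : C0Semigroup E)

/-- `T(t)x` is differentiable from the right at `t = 0`, with derivative `y`. -/
def HasGenerator (x y : E) : Prop :=
  Tendsto (fun t : ℝ≥0 => (((t : ℝ) : ℂ)⁻¹) • (T.op t x - x)) (𝓝[>] 0) (𝓝 y)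

variable {T}

theorem HasGenerator.unique {x y z : E} (h : T.HasGenerator x y) (h' : T.HasGenerator x z) :
    y = z :=
  tendsto_nhds_unique h h'

theorem HasGenerator.add {x y x' y' : E} (h : T.HasGenerator x y) (h' : T.HasGenerator x' y') :
    T.HasGenerator (x + x') (y + y') := by
  refine (Tendsto.add h h').congr fun t => ?_
  rw [← smul_add, map_add]
  congr 1
  abel

theorem HasGenerator.smul (c : ℂ) {x y : E} (h : T.HasGenerator x y) :
    T.HasGenerator (c • x) (c • y) := by
  refine (Tendsto.const_smul h c).congr fun t => ?_
  rw [smul_comm, map_smul, smul_sub c]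

theorem HasGenerator.zero : T.HasGenerator 0 0 := by
  simp [HasGenerator]

theorem HasGenerator.op (s : ℝ≥0) {x y : E} (h : T.HasGenerator x y) :
    T.HasGenerator (T.op s x) (T.op s y) := by
  refine (((T.op s).continuous.tendsto y).comp h).congr fun t => ?_
  have h1 : T.op s (T.op t x) = T.op t (T.op s x) := by
    have := T.op_add s t
    rw [add_comm, T.op_add t s] at this
    exact (DFunLike.congr_fun this x).symm
  simp [map_sub, h1]

variable (T)

/-- The infinitesimal generator of the semigroup: its domain consists of all `x` for which
`lim_{t ↓ 0} (T(t)x - x)/t` exists, and its value at `x` is this limit. -/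
def generator : E →ₗ.[ℂ] E where
  domain :=
    { carrier := {x | ∃ y, T.HasGenerator x y}
      add_mem' := fun ⟨_, h⟩ ⟨_, h'⟩ => ⟨_, h.add h'⟩
      zero_mem' := ⟨0, HasGenerator.zero⟩
      smul_mem' := fun c _ ⟨_, h⟩ => ⟨_, h.smul c⟩ }
  toFun :=
    { toFun := fun x => x.2.choose
      map_add' := fun x y =>
        (x + y).2.choose_spec.unique (x.2.choose_spec.add y.2.choose_spec)
      map_smul' := fun c x => (c • x).2.choose_spec.unique (x.2.choose_spec.smul c) }

/-- The operator `A` is the infinitesimal generator of the semigroup `T`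
(equality of operators includes equality of the domains). -/
def Generates (A : E →ₗ.[ℂ] E) : Prop := T.generator = A

/-- The domain of the generator is invariant under the semigroup. -/
theorem Generates.op_mem {T : C0Semigroup E} {A : E →ₗ.[ℂ] E} (h : T.Generates A) (t : ℝ≥0)
    {x : E} (hx : x ∈ A.domain) : T.op t x ∈ A.domain := by
  obtain rfl : T.generator = A := h
  obtain ⟨y, hy⟩ := hx
  exact ⟨_, hy.op t⟩

/-- `‖T(t)‖ ≤ M e^{-ωt}` for all `t ≥ 0`, with some `M ≥ 1` and `ω > 0`. -/
def ExponentiallyStable : Prop :=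
  ∃ M ω : ℝ, 1 ≤ M ∧ 0 < ω ∧ ∀ t : ℝ≥0, ‖T.op t‖ ≤ M * Real.exp (-ω * t)

/-- `‖T(t)x‖ → 0` as `t → ∞`, for all `x`. -/
def StronglyStable : Prop :=
  ∀ x, Tendsto (fun t : ℝ≥0 => ‖T.op t x‖) atTop (𝓝 0)

end C0Semigroup

variable {E Y : Type*} [NormedAddCommGroup E] [NormedSpace ℂ E]
  [NormedAddCommGroup Y] [NormedSpace ℂ Y]

/-- The Hautus test for `ẋ = Ax`, `y = Cx`, where `N` is the norm of the state space: for some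
`m > 0`, `‖(sI - A)x‖² + |Re s| ‖Cx‖² ≥ m |Re s|² ‖x‖²` for all `s` in the open left half plane
and all `x` in the domain of `A`. -/
def HautusTest (N : E → ℝ) (A : E →ₗ.[ℂ] E) (C : A.domain →ₗ[ℂ] Y) : Prop :=
  ∃ m : ℝ, 0 < m ∧ ∀ s : ℂ, s.re < 0 → ∀ x : A.domain,
    m * |s.re| ^ 2 * N x ^ 2 ≤ N (s • (x : E) - A x) ^ 2 + |s.re| * ‖C x‖ ^ 2

/-- Approximate observability in infinite time of `ẋ = Ax`, `y = Cx`, where `A` generates `T`: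
`∫₀^∞ ‖C T(t) x₀‖² dt > 0` for all `x₀ ≠ 0` in the domain of `A`. -/
def ApproximatelyObservable (T : C0Semigroup E) {A : E →ₗ.[ℂ] E} (hT : T.Generates A)
    (C : A.domain →ₗ[ℂ] Y) : Prop :=
  ∀ x₀ : A.domain, x₀ ≠ 0 →
    0 < ∫⁻ t in Ioi (0 : ℝ), ‖C ⟨T.op t.toNNReal x₀, hT.op_mem _ x₀.2⟩‖ₑ ^ 2

end Semigroups

/-! ### Function spaces on the unit interval -/

/-- Lebesgue measure on `[0, 1]`. -/
abbrev unitMeasure : Measure ℝ := volume.restrict (Icc (0 : ℝ) 1)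

/-- The space `L²(0, 1; ℂⁿ)`. -/
abbrev L2 (n : ℕ) : Type := Lp (EuclideanSpace ℂ (Fin n)) 2 unitMeasure

section FunctionSpaces

variable {n : ℕ}

theorem memLp_mulVec {M : ℝ → Matrix (Fin n) (Fin n) ℂ}
    (hM : ∀ i j, MemLp (fun ζ => M ζ i j) ∞ unitMeasure) (x : L2 n) :
    MemLp (fun ζ => (M ζ).toEuclideanLin (x ζ)) 2 unitMeasure := by
  refine MemLp.of_eval_piLp fun i => ?_
  have : (fun ζ => (M ζ).toEuclideanLin (x ζ) i) = fun ζ => ∑ j, M ζ i j * x ζ j := by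
    ext ζ
    simp [Matrix.toLpLin_apply, Matrix.mulVec, dotProduct]
  rw [this]
  exact memLp_finsetSum _ fun j _ => ((Lp.memLp x).eval_piLp j).mul (hM i j)

/-- Multiplication `x ↦ M x`, `(M x)(ζ) = M(ζ) x(ζ)`, by a matrix valued function
`M ∈ L^∞(0, 1; ℂ^{n × n})`, as an operator on `L²(0, 1; ℂⁿ)`. -/
def mulOp (M : ℝ → Matrix (Fin n) (Fin n) ℂ)
    (hM : ∀ i j, MemLp (fun ζ => M ζ i j) ∞ unitMeasure) : L2 n →ₗ[ℂ] L2 n where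
  toFun x := (memLp_mulVec hM x).toLp
  map_add' x y := by
    rw [← MemLp.toLp_add, MemLp.toLp_eq_toLp_iff]
    filter_upwards [Lp.coeFn_add x y] with ζ h
    rw [h, Pi.add_apply, Pi.add_apply, map_add]
  map_smul' c x := by
    rw [RingHom.id_apply, ← MemLp.toLp_const_smul, MemLp.toLp_eq_toLp_iff]
    filter_upwards [Lp.coeFn_smul c x] with ζ h
    rw [h, Pi.smul_apply, Pi.smul_apply, map_smul]

/-- Multiplication by a constant matrix, as an operator on `L²(0, 1; ℂⁿ)`. -/
def constOp (M : Matrix (Fin n) (Fin n) ℂ) : L2 n →ₗ[ℂ] L2 n :=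
  mulOp (fun _ => M) fun i j => memLp_top_const (M i j)

/-- `u ∈ L²(0, 1; ℂⁿ)` has the absolutely continuous representative `w` on `[0, 1]`, whose
derivative is `v ∈ L²(0, 1; ℂⁿ)`. -/
structure IsH1Rep (u v : L2 n) (w : ℝ → EuclideanSpace ℂ (Fin n)) : Prop where
  absCont : AbsolutelyContinuousOnInterval w 0 1
  ae_eq : u =ᵐ[unitMeasure] w
  hasDeriv : ∀ᵐ ζ ∂unitMeasure, HasDerivAt w (v ζ) ζ

namespace IsH1Rep

variable {u v u' v' : L2 n} {w w' : ℝ → EuclideanSpace ℂ (Fin n)}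

theorem add (h : IsH1Rep u v w) (h' : IsH1Rep u' v' w') :
    IsH1Rep (u + u') (v + v') (w + w') where
  absCont := h.absCont.add h'.absCont
  ae_eq := by
    filter_upwards [Lp.coeFn_add u u', h.ae_eq, h'.ae_eq] with ζ h1 h2 h3
    rw [h1, Pi.add_apply, Pi.add_apply, h2, h3]
  hasDeriv := by
    filter_upwards [Lp.coeFn_add v v', h.hasDeriv, h'.hasDeriv] with ζ h1 h2 h3
    rw [h1]
    exact h2.add h3

theorem smul (c : ℂ) (h : IsH1Rep u v w) : IsH1Rep (c • u) (c • v) (c • w) where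
  absCont := h.absCont.const_smul c
  ae_eq := by
    filter_upwards [Lp.coeFn_smul c u, h.ae_eq] with ζ h1 h2
    rw [h1, Pi.smul_apply, Pi.smul_apply, h2]
  hasDeriv := by
    filter_upwards [Lp.coeFn_smul c v, h.hasDeriv] with ζ h1 h2
    rw [h1]
    exact h2.const_smul c

theorem zero : IsH1Rep (0 : L2 n) 0 0 where
  absCont := (LipschitzWith.const 0).lipschitzOnWith.absolutelyContinuousOnInterval
  ae_eq := Lp.coeFn_zero _ _ _
  hasDeriv := by
    filter_upwards [Lp.coeFn_zero (EuclideanSpace ℂ (Fin n)) 2 unitMeasure] with ζ h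
    rw [h]
    exact hasDerivAt_const ζ 0

theorem eqOn (h : IsH1Rep u v w) (h' : IsH1Rep u v' w') : EqOn w w' (Icc 0 1) := by
  have hc := h.absCont.continuousOn
  have hc' := h'.absCont.continuousOn
  rw [uIcc_of_le zero_le_one] at hc hc'
  exact Measure.eqOn_Icc_of_ae_eq volume zero_ne_one (h.ae_eq.symm.trans h'.ae_eq) hc hc'

theorem unique (h : IsH1Rep u v w) (h' : IsH1Rep u v' w') : v = v' := by
  refine Lp.ext ?_
  have hIoo : ∀ᵐ ζ ∂unitMeasure, ζ ∈ Ioo (0 : ℝ) 1 := by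
    rw [unitMeasure, ← Measure.restrict_congr_set Ioo_ae_eq_Icc]
    exact ae_restrict_mem measurableSet_Ioo
  filter_upwards [hIoo, h.hasDeriv, h'.hasDeriv] with ζ hζ h1 h2
  have : w =ᶠ[𝓝 ζ] w' := by
    filter_upwards [Icc_mem_nhds hζ.1 hζ.2] with z hz using h.eqOn h' hz
  exact h1.unique (h2.congr_of_eventuallyEq this)

end IsH1Rep

/-- The Sobolev space `H¹(0, 1; ℂⁿ)`: the (classes of) absolutely continuous functions on
`[0, 1]` with square integrable derivative. -/
def H1 (n : ℕ) : Submodule ℂ (L2 n) where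
  carrier := {u | ∃ v w, IsH1Rep u v w}
  add_mem' := fun ⟨_, _, h⟩ ⟨_, _, h'⟩ => ⟨_, _, h.add h'⟩
  zero_mem' := ⟨_, _, IsH1Rep.zero⟩
  smul_mem' := fun c _ ⟨_, _, h⟩ => ⟨_, _, h.smul c⟩

namespace H1

/-- The derivative `d/dζ : H¹(0, 1; ℂⁿ) → L²(0, 1; ℂⁿ)`. -/
def deriv : H1 n →ₗ[ℂ] L2 n where
  toFun u := u.2.choose
  map_add' u u' :=
    (u + u').2.choose_spec.choose_spec.unique
      (u.2.choose_spec.choose_spec.add u'.2.choose_spec.choose_spec)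
  map_smul' c u :=
    (c • u).2.choose_spec.choose_spec.unique (u.2.choose_spec.choose_spec.smul c)

/-- The value `u(ζ)`, `ζ ∈ [0, 1]`, of (the continuous representative of) `u ∈ H¹(0, 1; ℂⁿ)`. -/
def eval (ζ : ℝ) (hζ : ζ ∈ Icc (0 : ℝ) 1) : H1 n →ₗ[ℂ] EuclideanSpace ℂ (Fin n) where
  toFun u := u.2.choose_spec.choose ζ
  map_add' u u' :=
    (u + u').2.choose_spec.choose_spec.eqOn
      (u.2.choose_spec.choose_spec.add u'.2.choose_spec.choose_spec) hζ
  map_smul' c u :=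
    (c • u).2.choose_spec.choose_spec.eqOn (u.2.choose_spec.choose_spec.smul c) hζ

/-- `M₁ u(1) + M₀ u(0)`, that is, the matrix `[M₁ M₀]` applied to the boundary values
`(u(1), u(0))`. -/
def boundaryMap (M₁ M₀ : Matrix (Fin n) (Fin n) ℂ) : H1 n →ₗ[ℂ] EuclideanSpace ℂ (Fin n) :=
  M₁.toEuclideanLin ∘ₗ eval 1 (right_mem_Icc.2 zero_le_one) +
    M₀.toEuclideanLin ∘ₗ eval 0 (left_mem_Icc.2 zero_le_one)

end H1

end FunctionSpaces

/-! ### Port-Hamiltonian systems -/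

/-- The data of a linear first order port-Hamiltonian system
`∂x/∂t = (P₁ ∂/∂ζ + G₀)(ℋ x)`, `0 = W_{B,1} (ℋx)(1) + W_{B,0} (ℋx)(0)`,
`y = W_{C,1} (ℋx)(1) + W_{C,0} (ℋx)(0)` on `[0, 1]`. -/
structure PortHamiltonianSystem (n : ℕ) where
  P₁ : Matrix (Fin n) (Fin n) ℂ
  G₀ : Matrix (Fin n) (Fin n) ℂ
  W_B₁ : Matrix (Fin n) (Fin n) ℂ
  W_B₀ : Matrix (Fin n) (Fin n) ℂ
  W_C₁ : Matrix (Fin n) (Fin n) ℂ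
  W_C₀ : Matrix (Fin n) (Fin n) ℂ
  ℋ : ℝ → Matrix (Fin n) (Fin n) ℂ
  isHermitian_P₁ : P₁.IsHermitian
  isUnit_P₁ : IsUnit P₁
  rank_W_B : (Matrix.fromCols W_B₁ W_B₀).rank = n
  rank_W_C : (Matrix.fromCols W_C₁ W_C₀).rank = n
  posDef_ℋ : ∀ᵐ ζ ∂unitMeasure, (ℋ ζ).PosDef
  memLp_ℋ : ∀ i j, MemLp (fun ζ => ℋ ζ i j) ∞ unitMeasure
  memLp_ℋ_inv : ∀ i j, MemLp (fun ζ => (ℋ ζ)⁻¹ i j) ∞ unitMeasure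
  /-- `P₁ ℋ = S⁻¹ Δ S` a.e. on `[0, 1]`, with `Δ` diagonal, `S` invertible, and `S`, `S⁻¹`, `Δ`
  continuously differentiable on `[0, 1]` -/
  exists_diagonalization : ∃ (S : ℝ → Matrix (Fin n) (Fin n) ℂ) (Δ : ℝ → Fin n → ℂ),
    (∀ᵐ ζ ∂unitMeasure, IsUnit (S ζ) ∧ P₁ * ℋ ζ = (S ζ)⁻¹ * Matrix.diagonal (Δ ζ) * S ζ) ∧
    (∀ i j, ContDiffOn ℝ 1 (fun ζ => S ζ i j) (Icc 0 1)) ∧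
    (∀ i j, ContDiffOn ℝ 1 (fun ζ => (S ζ)⁻¹ i j) (Icc 0 1)) ∧
    (∀ i, ContDiffOn ℝ 1 (fun ζ => Δ ζ i) (Icc 0 1))

namespace PortHamiltonianSystem

variable {n : ℕ} (𝒮 : PortHamiltonianSystem n)

/-- The operator `x ↦ ℋ x` on `L²(0, 1; ℂⁿ)`. -/
def opH : L2 n →ₗ[ℂ] L2 n := mulOp 𝒮.ℋ 𝒮.memLp_ℋ

/-- The energy norm `√⟨x, ℋ x⟩`, where `⟨·, ·⟩` is the inner product of `L²(0, 1; ℂⁿ)`. As `ℋ` and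
`ℋ⁻¹` are essentially bounded, it is equivalent to the norm of `L²(0, 1; ℂⁿ)`. -/
def energyNorm (x : L2 n) : ℝ := √(inner ℂ x (𝒮.opH x)).re

/-- The domain of `A`: all `x` with `ℋx ∈ H¹(0, 1; ℂⁿ)` and
`W_{B,1} (ℋx)(1) + W_{B,0} (ℋx)(0) = 0`. -/
def domA : Submodule ℂ (L2 n) where
  carrier := {x | ∃ h : 𝒮.opH x ∈ H1 n, H1.boundaryMap 𝒮.W_B₁ 𝒮.W_B₀ ⟨𝒮.opH x, h⟩ = 0}
  add_mem' := by
    rintro x y ⟨h, h0⟩ ⟨h', h0'⟩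
    refine ⟨by rw [map_add]; exact add_mem h h', ?_⟩
    have := congrArg₂ (· + ·) h0 h0'
    simpa only [← map_add, AddMemClass.mk_add_mk, add_zero] using this
  zero_mem' := by
    refine ⟨by rw [map_zero]; exact zero_mem _, ?_⟩
    have : (⟨𝒮.opH 0, by rw [map_zero]; exact zero_mem _⟩ : H1 n) = 0 :=
      Subtype.ext (map_zero _)
    rw [this, map_zero]
  smul_mem' := by
    rintro c x ⟨h, h0⟩
    refine ⟨by rw [map_smul]; exact Submodule.smul_mem _ c h, ?_⟩
    have := congrArg (c • ·) h0
    simpa only [← map_smul, SetLike.mk_smul_mk, smul_zero] using this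

/-- The map `x ↦ ℋ x` from the domain of `A` to `H¹(0, 1; ℂⁿ)`. -/
def domAToH1 : 𝒮.domA →ₗ[ℂ] H1 n :=
  (𝒮.opH ∘ₗ 𝒮.domA.subtype).codRestrict (H1 n) fun x => x.2.choose

/-- The operator `A x = (P₁ d/dζ + G₀)(ℋ x)` with domain `domA`. -/
def A : L2 n →ₗ.[ℂ] L2 n where
  domain := 𝒮.domA
  toFun :=
    (constOp 𝒮.P₁ ∘ₗ H1.deriv + constOp 𝒮.G₀ ∘ₗ (H1 n).subtype) ∘ₗ 𝒮.domAToH1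

/-- The output operator `C x = W_{C,1} (ℋx)(1) + W_{C,0} (ℋx)(0)`. -/
def C : 𝒮.A.domain →ₗ[ℂ] EuclideanSpace ℂ (Fin n) :=
  H1.boundaryMap 𝒮.W_C₁ 𝒮.W_C₀ ∘ₗ 𝒮.domAToH1

/-- The matrix `[[W_{B,1}, W_{B,0}], [W_{C,1}, W_{C,0}]]`. -/
def W_BC : Matrix (Fin n ⊕ Fin n) (Fin n ⊕ Fin n) ℂ :=
  Matrix.fromBlocks 𝒮.W_B₁ 𝒮.W_B₀ 𝒮.W_C₁ 𝒮.W_C₀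

/-- `Re G₀ = (G₀ + G₀*)/2`. -/
def reG₀ : Matrix (Fin n) (Fin n) ℂ := (1 / 2 : ℂ) • (𝒮.G₀ + 𝒮.G₀.conjTranspose)

/-- The operator `A - (Re G₀)ℋ`, with the domain of `A`. -/
def ASubReG₀H : L2 n →ₗ.[ℂ] L2 n :=
  𝒮.A - (constOp 𝒮.reG₀ ∘ₗ 𝒮.opH).toPMap ⊤

end PortHamiltonianSystem

end

/-!
Write `z = (s - A) x` and `w = ℋ x`, so that `P₁ w' = s x - z - G₀ w`. As `W_BC` is invertible, the
boundary condition makes `w(0)` and `w(1)` linear functions of the output `C x`.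

For the Hautus test the open left half plane is covered by three regions.

* For large `|Re s|`, the derivative of the flux `⟨w, P₁ w⟩` is integrated over `[0, 1]`: this bounds
  `|Re s| ‖x‖²` by boundary values and `‖z‖ ‖x‖`, with an error `O(‖x‖²)` due to `G₀` which is
  absorbed (`PortHamiltonianSystem.exists_energy_estimate`).
* For small `|Re s|`, exponential stability bounds the resolvent of `A`
  (`C0Semigroup.norm_le_of_hasGenerator`).
* In between, with `P₁ ℋ = S⁻¹ Δ S`, the function `y = S P₁ w` satisfies a differential equation in
  which `s` only occurs as `s Δ⁻¹ y` with `Δ` real. Hence `‖y‖²` grows at a rate that does not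
  depend on `Im s`, and Gronwall's inequality, started from `y(0)`, gives
  `‖x‖² ≤ K (‖z‖² + ‖C x‖²)` uniformly on vertical strips
  (`PortHamiltonianSystem.exists_strip_estimate`).

These estimates are proved in the norm of `L²(0, 1; ℂⁿ)`, to which the energy norm is equivalent.

Approximate observability follows from the Hautus test and exponential stability alone, for any
output which is bounded in the graph norm of `A`
(`C0Semigroup.approximatelyObservable_of_hautusTest`). Let `R = (-A)⁻¹`. If `C T(t) x₀ = 0` for
almost all `t`, then `A x₀` lies in the closed `R`-invariant subspace
`W = {y | C R T(t) y = 0 for all t}`. For `y ∈ W` and `x = R y` one has `C x = 0` and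
`(s - A) x = (1 + s R) y`, so that the lower bounds on `s - A` make `1 + s R` invertible on `W` for
every `s`, and `R (1 + s R)⁻¹` a bounded entire function that tends to zero as `s → -∞`. By
Liouville's theorem it vanishes, whence `R = 0` on `W` and `x₀ = -R A x₀ = 0`
(`eq_zero_of_bounded_below`).
-/

/-! ### Operators with entire resolvent -/

section BoundedOperators

variable {F : Type*} [NormedAddCommGroup F] [NormedSpace ℂ F] [CompleteSpace F]

/-- The set of `s` for which `1 + s R` is invertible is open and contains `0`; it is closed because
the hypothesis bounds the inverses locally uniformly. -/
theorem isUnit_one_add_smul_of_bounded_below (R : F →L[ℂ] F) {c : ℝ} (hc : 0 < c)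
    (h : ∀ (s : ℂ) (y : F), c * ‖R y‖ ≤ ‖y + s • R y‖) (s : ℂ) : IsUnit (1 + s • R) := by
  have hcont : Continuous fun s : ℂ => 1 + s • R := by fun_prop
  have hopen : IsOpen {s : ℂ | IsUnit (1 + s • R)} := Units.isOpen.preimage hcont
  have hbelow : ∀ (s : ℂ) (y : F), ‖y‖ ≤ (1 + ‖s‖ / c) * ‖(1 + s • R) y‖ := by
    intro s y
    have h1 : ‖y‖ ≤ ‖y + s • R y‖ + ‖s‖ * ‖R y‖ := by
      have := norm_sub_le (y + s • R y) (s • R y)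
      rwa [add_sub_cancel_right, norm_smul] at this
    have h2 : ‖R y‖ ≤ ‖y + s • R y‖ / c := by
      rw [le_div_iff₀ hc, mul_comm]
      exact h s y
    have h3 : ‖s‖ * ‖R y‖ ≤ ‖s‖ * (‖y + s • R y‖ / c) := by gcongr
    have h4 : (1 + s • R) y = y + s • R y := by simp
    rw [h4]
    calc ‖y‖ ≤ ‖y + s • R y‖ + ‖s‖ * (‖y + s • R y‖ / c) := by linarith
      _ = _ := by ring
  have hclosed : IsClosed {s : ℂ | IsUnit (1 + s • R)} := by
    refine isClosed_of_closure_subset fun s hs => ?_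
    -- The inverses are bounded by `K` near `s`, so a unit `1 + t • R` with `t` close enough to `s`
    -- has `1 + s • R` in the ball of units around it.
    set K : ℝ := 1 + (‖s‖ + 1) / c with hK
    have hKpos : 0 < K := by positivity
    have hev : ∀ᶠ t in 𝓝 s, ‖t‖ < ‖s‖ + 1 ∧ ‖(1 + s • R) - (1 + t • R)‖ < K⁻¹ := by
      refine ((continuous_norm.tendsto s).eventually (gt_mem_nhds (lt_add_one _))).and ?_
      have : Tendsto (fun t : ℂ => ‖(1 + s • R) - (1 + t • R)‖) (𝓝 s)
          (𝓝 ‖(1 + s • R) - (1 + s • R)‖) :=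
        ((continuous_const.sub hcont).norm).tendsto s
      rw [sub_self, norm_zero] at this
      exact this.eventually (gt_mem_nhds (inv_pos.2 hKpos))
    obtain ⟨t, ⟨u, hu⟩, ht1, ht2⟩ := ((mem_closure_iff_frequently.1 hs).and_eventually hev).exists
    rcases subsingleton_or_nontrivial F with hF | hF
    · have : Subsingleton (F →L[ℂ] F) := ⟨fun a b => by ext; exact Subsingleton.elim _ _⟩
      change IsUnit (1 + s • R)
      rw [Subsingleton.elim (1 + s • R) 1]
      exact isUnit_one
    have hinv : ‖(↑u⁻¹ : F →L[ℂ] F)‖ ≤ K := by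
      refine ContinuousLinearMap.opNorm_le_bound _ hKpos.le fun y => ?_
      have h5 := hbelow t ((↑u⁻¹ : F →L[ℂ] F) y)
      rw [← hu, ← mul_apply_eq_comp, u.mul_inv, one_apply_eq_self] at h5
      refine h5.trans ?_
      rw [hK]
      gcongr
    have hlt : ‖(1 + s • R) - ↑u‖ < ‖(↑u⁻¹ : F →L[ℂ] F)‖⁻¹ := by
      rw [hu]
      refine ht2.trans_le ?_
      gcongr
      exact Units.norm_pos _
    exact (Units.ofNearby u _ hlt).isUnit
  have huniv : {s : ℂ | IsUnit (1 + s • R)} = univ :=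
    IsClopen.eq_univ ⟨hclosed, hopen⟩ ⟨0, by simp⟩
  exact huniv.ge (mem_univ s)

/-- By Liouville's theorem `R (1 + s R)⁻¹` is constant, equal to its value `R` at `s = 0`, and it
decays as `s → -∞` along the real axis. -/
theorem eq_zero_of_bounded_below (R : F →L[ℂ] F) {c : ℝ} (hc : 0 < c)
    (h : ∀ (s : ℂ) (y : F), c * ‖R y‖ ≤ ‖y + s • R y‖)
    (h' : ∀ s : ℂ, s.re < 0 → ∀ y : F, c * |s.re| * ‖R y‖ ≤ ‖y + s • R y‖) : R = 0 := by
  have hunit := isUnit_one_add_smul_of_bounded_below R hc h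
  set G : ℂ → F →L[ℂ] F := fun s => R * Ring.inverse (1 + s • R) with hG
  have hGapp : ∀ (s : ℂ) (y : F),
      (Ring.inverse (1 + s • R)) y + s • R (Ring.inverse (1 + s • R) y) = y := by
    intro s y
    have := congrArg (fun B : F →L[ℂ] F => B y) (Ring.mul_inverse_cancel _ (hunit s))
    simpa using this
  have hdiff : Differentiable ℂ G := by
    intro s
    refine (differentiableAt_const _).mul ?_
    have h1 : DifferentiableAt ℂ (fun s : ℂ => 1 + s • R) s := by fun_prop
    exact DifferentiableAt.comp s (differentiableAt_inverse (hunit s)) h1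
  have hbound : ∀ s, ‖G s‖ ≤ c⁻¹ := fun s => by
    refine ContinuousLinearMap.opNorm_le_bound _ (inv_nonneg.2 hc.le) fun y => ?_
    have := h s (Ring.inverse (1 + s • R) y)
    rw [hGapp] at this
    rw [inv_mul_eq_div, le_div_iff₀ hc, mul_comm]
    exact this
  have hconst : ∀ s, G s = R := fun s => by
    have h0 : G 0 = R := by simp [hG]
    rw [← h0]
    refine hdiff.apply_eq_apply_of_bounded ?_ s 0
    rw [isBounded_iff_forall_norm_le]
    exact ⟨c⁻¹, by rintro _ ⟨s, rfl⟩; exact hbound s⟩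
  ext y
  have hdecay : ∀ k : ℕ, (k + 1 : ℝ) * (c * ‖R y‖) ≤ ‖y‖ := fun k => by
    have h1 := h' (-(k + 1 : ℝ) : ℝ) 
      (by rw [Complex.ofReal_re]; linarith [k.cast_nonneg (α := ℝ)])
      (Ring.inverse (1 + ((-(k + 1 : ℝ) : ℝ) : ℂ) • R) y)
    rw [hGapp] at h1
    have h2 : R (Ring.inverse (1 + ((-(k + 1 : ℝ) : ℝ) : ℂ) • R) y) = R y :=
      congrArg (fun B : F →L[ℂ] F => B y) (hconst ((-(k + 1 : ℝ) : ℝ) : ℂ))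
    rw [h2, Complex.ofReal_re, abs_neg, abs_of_pos (by positivity)] at h1
    linarith
  by_contra hne
  have hpos : 0 < c * ‖R y‖ := mul_pos hc (norm_pos_iff.2 hne)
  obtain ⟨k, hk⟩ := exists_nat_gt (‖y‖ / (c * ‖R y‖))
  rw [div_lt_iff₀ hpos] at hk
  nlinarith [hdecay k]

end BoundedOperators

/-! ### Exponentially stable semigroups -/

namespace C0Semigroup

variable {E : Type*} [NormedAddCommGroup E] [NormedSpace ℂ E] {T : C0Semigroup E}
  {A : E →ₗ.[ℂ] E}

theorem Generates.hasGenerator (h : T.Generates A) (x : A.domain) : T.HasGenerator x (A x) := by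
  obtain rfl : T.generator = A := h
  exact x.2.choose_spec

theorem Generates.mem_domain (h : T.Generates A) {x y : E} (hxy : T.HasGenerator x y) :
    x ∈ A.domain := by
  obtain rfl : T.generator = A := h
  exact ⟨y, hxy⟩

theorem Generates.apply_eq (h : T.Generates A) {x y : E} (hxy : T.HasGenerator x y) :
    A ⟨x, h.mem_domain hxy⟩ = y :=
  (h.hasGenerator ⟨x, h.mem_domain hxy⟩).unique hxy

theorem Generates.apply_op (h : T.Generates A) (t : ℝ≥0) (x : A.domain) :
    A ⟨T.op t x, h.op_mem t x.2⟩ = T.op t (A x) :=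
  h.apply_eq ((h.hasGenerator x).op t)

theorem continuous_orbit {M : ℝ} (hM : ∀ t, ‖T.op t‖ ≤ M) (x : E) :
    Continuous fun t => T.op t x := by
  have key : ∀ s t, s ≤ t → ‖T.op t x - T.op s x‖ ≤ M * ‖T.op (t - s) x - x‖ := fun s t hst => by
    have h1 : T.op t x = T.op s (T.op (t - s) x) := by
      conv_lhs => rw [← add_tsub_cancel_of_le hst, T.op_add]
      rfl
    rw [h1, ← map_sub]
    exact (T.op s).le_of_opNorm_le (hM s) _
  have key' : ∀ s t, ‖T.op t x - T.op s x‖ ≤ M * ‖T.op (nndist t s) x - x‖ := fun s t => by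
    rcases le_total s t with hst | hst
    · have : nndist t s = t - s := by simp [NNReal.nndist_eq, tsub_eq_zero_of_le hst]
      rw [this]
      exact key s t hst
    · have : nndist t s = s - t := by simp [NNReal.nndist_eq, tsub_eq_zero_of_le hst]
      rw [this, norm_sub_rev]
      exact key t s hst
  refine continuous_iff_continuousAt.2 fun s => tendsto_iff_norm_sub_tendsto_zero.2 ?_
  have h0 : Tendsto (fun t => nndist t s) (𝓝 s) (𝓝 0) := by
    have : Continuous fun t => nndist t s := by fun_prop
    simpa using this.tendsto s
  refine squeeze_zero (fun _ => norm_nonneg _) (key' s) ?_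
  have := (((T.strongly_continuous x).comp h0).sub_const x).norm.const_mul M
  simpa using this

theorem continuous_orbit_toNNReal {M : ℝ} (hM : ∀ t, ‖T.op t‖ ≤ M) (y : E) :
    Continuous fun t : ℝ => T.op t.toNNReal y :=
  (continuous_orbit hM y).comp continuous_real_toNNReal

theorem norm_op_le {M ω : ℝ} (hM : 0 ≤ M) (hω : 0 < ω)
    (hT : ∀ t : ℝ≥0, ‖T.op t‖ ≤ M * Real.exp (-ω * t)) (t : ℝ≥0) : ‖T.op t‖ ≤ M := by
  refine (hT t).trans (mul_le_of_le_one_right hM (Real.exp_le_one_iff.2 ?_))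
  nlinarith [mul_nonneg hω.le t.2]

theorem norm_orbit_le {M ω : ℝ} (hT : ∀ t : ℝ≥0, ‖T.op t‖ ≤ M * Real.exp (-ω * t)) (y : E)
    {t : ℝ} (ht : 0 ≤ t) : ‖T.op t.toNNReal y‖ ≤ M * Real.exp (-ω * t) * ‖y‖ := by
  have := (T.op t.toNNReal).le_of_opNorm_le (hT _) y
  rwa [Real.coe_toNNReal _ ht] at this

theorem integrableOn_orbit {M ω : ℝ} (hM : 0 ≤ M) (hω : 0 < ω)
    (hT : ∀ t : ℝ≥0, ‖T.op t‖ ≤ M * Real.exp (-ω * t)) (y : E) :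
    IntegrableOn (fun t : ℝ => T.op t.toNNReal y) (Ioi 0) := by
  refine Integrable.mono' (((exp_neg_integrableOn_Ioi 0 hω).const_mul M).mul_const ‖y‖)
    (continuous_orbit_toNNReal (norm_op_le hM hω hT) y).aestronglyMeasurable ?_
  filter_upwards [ae_restrict_mem measurableSet_Ioi] with t ht
  exact norm_orbit_le hT y (le_of_lt ht)

/-- For an exponentially stable semigroup the operator `y ↦ ∫₀^∞ T(t) y dt` is bounded; it is the
inverse of `-A`. -/
theorem exists_integral_operator {M ω : ℝ} (hM : 0 ≤ M) (hω : 0 < ω)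
    (hT : ∀ t : ℝ≥0, ‖T.op t‖ ≤ M * Real.exp (-ω * t)) :
    ∃ R : E →L[ℂ] E, ∀ y, R y = ∫ t in Ioi (0 : ℝ), T.op t.toNNReal y := by
  have hint := integrableOn_orbit hM hω hT
  refine ⟨LinearMap.mkContinuous
    { toFun := fun y => ∫ t in Ioi (0 : ℝ), T.op t.toNNReal y
      map_add' := fun x y => ?_
      map_smul' := fun a y => ?_ } (∫ t in Ioi (0 : ℝ), M * Real.exp (-ω * t)) fun y => ?_,
    fun y => rfl⟩
  · simp only [map_add]
    exact integral_add (hint x) (hint y)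
  · simp only [map_smul, RingHom.id_apply]
    exact integral_smul a _
  · change ‖∫ t in Ioi (0 : ℝ), T.op t.toNNReal y‖ ≤ _
    rw [← integral_mul_const]
    refine norm_integral_le_of_norm_le
      (((exp_neg_integrableOn_Ioi 0 hω).const_mul M).mul_const ‖y‖) ?_
    filter_upwards [ae_restrict_mem measurableSet_Ioi] with t ht
    exact norm_orbit_le hT y (le_of_lt ht)

/-- Orbits starting in the domain of the generator are differentiable from the right. -/
theorem HasGenerator.hasDerivWithinAt {x y : E} (h : T.HasGenerator x y) {t : ℝ} (ht : 0 ≤ t) :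
    HasDerivWithinAt (fun t : ℝ => T.op t.toNNReal x) (T.op t.toNNReal y) (Ici t) t := by
  rw [hasDerivWithinAt_iff_tendsto_slope, Ici_sdiff_left]
  have hlim : Tendsto (fun u : ℝ => (u - t).toNNReal) (𝓝[>] t) (𝓝[>] 0) := by
    refine tendsto_nhdsWithin_iff.2 ⟨?_, ?_⟩
    · have : Continuous fun u : ℝ => (u - t).toNNReal := by fun_prop
      have := this.tendsto t
      rw [sub_self, Real.toNNReal_zero] at this
      exact this.mono_left nhdsWithin_le_nhds
    · filter_upwards [self_mem_nhdsWithin] with u hu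
      exact Real.toNNReal_pos.2 (sub_pos.2 hu)
  refine (Tendsto.comp (h.op t.toNNReal) hlim).congr' ?_
  filter_upwards [self_mem_nhdsWithin] with u hu
  have hu' : t < u := hu
  have h1 : u.toNNReal = (u - t).toNNReal + t.toNNReal := by
    rw [← Real.toNNReal_add (sub_pos.2 hu').le ht, sub_add_cancel]
  simp only [Function.comp_apply, slope, vsub_eq_sub]
  rw [Real.coe_toNNReal _ (sub_pos.2 hu').le, h1, T.op_add, ← Complex.ofReal_inv,
    Complex.coe_smul]
  rfl

/-- If `‖T(t)‖ ≤ M e^{-ωt}`, then the resolvent of the generator is bounded on every half plane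
`Re s ≥ -(ω - δ)`: this follows by integrating the derivative `-e^{-st} T(t) (s - A) x` of
`e^{-st} T(t) x` over `[0, ∞)`. -/
theorem norm_le_of_hasGenerator {M ω δ : ℝ} (hM : 0 ≤ M)
    (hT : ∀ t : ℝ≥0, ‖T.op t‖ ≤ M * Real.exp (-ω * t)) (hδ : 0 < δ) (hδω : δ ≤ ω)
    {x y : E} (h : T.HasGenerator x y) {s : ℂ} (hs : δ - ω ≤ s.re) :
    ‖x‖ ≤ M / δ * ‖s • x - y‖ := by
  set z := s • x - y with hz
  have hb := norm_op_le hM (hδ.trans_le hδω) hT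
  set f : ℝ → E := fun t => Complex.exp (-s * t) • T.op t.toNNReal x with hf
  have hexp : ∀ t : ℝ, ‖Complex.exp (-s * t)‖ = Real.exp (-s.re * t) := fun t => by
    rw [Complex.norm_exp]
    simp
  have hle : ∀ t : ℝ, 0 ≤ t → ∀ w, ‖Complex.exp (-s * t) • T.op t.toNNReal w‖ ≤
      M * Real.exp (-δ * t) * ‖w‖ := fun t ht w => by
    have h1 := (T.op t.toNNReal).le_of_opNorm_le (hT _) w
    rw [Real.coe_toNNReal _ ht] at h1
    rw [norm_smul, hexp]
    calc Real.exp (-s.re * t) * ‖T.op t.toNNReal w‖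
        ≤ Real.exp ((ω - δ) * t) * (M * Real.exp (-ω * t) * ‖w‖) := by
          gcongr
          linarith
      _ = M * (Real.exp ((ω - δ) * t) * Real.exp (-ω * t)) * ‖w‖ := by ring
      _ = _ := by
          rw [← Real.exp_add]
          ring_nf
  have hcont : Continuous f := by
    refine Continuous.smul (by fun_prop) ?_
    exact continuous_orbit_toNNReal hb x
  have hderiv : ∀ t : ℝ, 0 ≤ t →
      HasDerivWithinAt f (-(Complex.exp (-s * t) • T.op t.toNNReal z)) (Ici t) t := fun t ht => by
    have h1 : HasDerivWithinAt (fun t : ℝ => Complex.exp (-s * t))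
        (Complex.exp (-s * t) * (-s)) (Ici t) t := by
      have h2 : HasDerivAt (fun t : ℝ => -s * (t : ℂ)) (-s * 1) t :=
        (Complex.ofRealCLM.hasDerivAt (x := t)).const_mul (-s)
      rw [mul_one] at h2
      exact h2.cexp.hasDerivWithinAt
    refine (h1.smul (h.hasDerivWithinAt ht)).congr_deriv ?_
    rw [hz, map_sub, map_smul, smul_sub, smul_smul, mul_neg, neg_smul]
    abel
  have hbd : ∀ t : ℝ, 0 ≤ t →
      ‖f t - x‖ ≤ M / δ * ‖z‖ * (1 - Real.exp (-δ * t)) := fun t ht => by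
    have hB : ∀ u : ℝ, HasDerivAt (fun u => M / δ * ‖z‖ * (1 - Real.exp (-δ * u)))
        (M * Real.exp (-δ * u) * ‖z‖) u := fun u => by
      have h2 : HasDerivAt (fun u : ℝ => -δ * u) (-δ * 1) u := (hasDerivAt_id u).const_mul _
      refine ((h2.exp.const_sub 1).const_mul (M / δ * ‖z‖)).congr_deriv ?_
      field_simp
    refine image_norm_le_of_norm_deriv_right_le_deriv_boundary' (a := 0) (b := t)
      (f := fun u => f u - x)
      (f' := fun u => -(Complex.exp (-s * u) • T.op u.toNNReal z))
      (hcont.sub continuous_const).continuousOn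
      (fun u hu => (hderiv u hu.1).sub_const x) ?_ (fun u _ => (hB u).continuousAt.continuousWithinAt)
      (fun u _ => (hB u).hasDerivWithinAt) (fun u hu => ?_) ⟨ht, le_rfl⟩
    · simp [hf, T.op_zero]
    · rw [norm_neg]
      exact hle u hu.1 z
  have hmain : ∀ t : ℝ, 0 ≤ t → ‖x‖ ≤ M * Real.exp (-δ * t) * ‖x‖ + M / δ * ‖z‖ := fun t ht => by
    have h1 := hbd t ht
    have h2 := hle t ht x
    have h3 : ‖x‖ ≤ ‖f t‖ + ‖f t - x‖ := by
      have := norm_sub_le (f t) (f t - x)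
      rwa [sub_sub_cancel] at this
    have h4 : M / δ * ‖z‖ * (1 - Real.exp (-δ * t)) ≤ M / δ * ‖z‖ := by
      refine mul_le_of_le_one_right (by positivity) ?_
      linarith [Real.exp_pos (-δ * t)]
    linarith
  have hlim : Tendsto (fun t : ℝ => M * Real.exp (-δ * t) * ‖x‖ + M / δ * ‖z‖) atTop
      (𝓝 (M * 0 * ‖x‖ + M / δ * ‖z‖)) := by
    have h5 : Tendsto (fun t : ℝ => Real.exp (-δ * t)) atTop (𝓝 0) :=
      Real.tendsto_exp_atBot.comp (tendsto_id.const_mul_atTop_of_neg (neg_lt_zero.2 hδ))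
    exact ((h5.const_mul M).mul_const ‖x‖).add_const _
  have := ge_of_tendsto hlim ((eventually_ge_atTop 0).mono hmain)
  simpa using this

/-! ### Approximate observability from the Hautus test -/

variable [CompleteSpace E] {Y : Type*} [NormedAddCommGroup Y] [NormedSpace ℂ Y] [CompleteSpace Y]

theorem op_integral_orbit {M ω : ℝ} (hM : 0 ≤ M) (hω : 0 < ω)
    (hT : ∀ t : ℝ≥0, ‖T.op t‖ ≤ M * Real.exp (-ω * t)) (y : E) (h : ℝ≥0) :
    T.op h (∫ t in Ioi (0 : ℝ), T.op t.toNNReal y) = ∫ t in Ioi (h : ℝ), T.op t.toNNReal y := by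
  rw [← (T.op h).integral_comp_comm (integrableOn_orbit hM hω hT y)]
  have h1 := (measurePreserving_add_right volume (h : ℝ)).setIntegral_preimage_emb
    (measurableEmbedding_addRight (h : ℝ)) (fun t => T.op t.toNNReal y) (Ioi (h : ℝ))
  rw [← h1]
  have h2 : (fun x : ℝ => x + h) ⁻¹' Ioi (h : ℝ) = Ioi 0 := by
    ext t
    simp
  rw [h2]
  refine setIntegral_congr_fun measurableSet_Ioi fun t ht => ?_
  have h3 : (t + h).toNNReal = h + t.toNNReal := by
    rw [Real.toNNReal_add (le_of_lt ht) h.coe_nonneg, Real.toNNReal_coe, add_comm]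
  simp only [h3, T.op_add]
  rfl

theorem hasGenerator_integral_orbit {M ω : ℝ} (hM : 0 ≤ M) (hω : 0 < ω)
    (hT : ∀ t : ℝ≥0, ‖T.op t‖ ≤ M * Real.exp (-ω * t)) (y : E) :
    T.HasGenerator (∫ t in Ioi (0 : ℝ), T.op t.toNNReal y) (-y) := by
  have hc := continuous_orbit_toNNReal (norm_op_le hM hω hT) y
  have h1 : HasDerivAt (fun u : ℝ => ∫ t in (0 : ℝ)..u, T.op t.toNNReal y)
      (T.op (0 : ℝ).toNNReal y) 0 :=
    intervalIntegral.integral_hasDerivAt_right (hc.intervalIntegrable _ _)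
      (hc.stronglyMeasurableAtFilter _ _) hc.continuousAt
  rw [Real.toNNReal_zero, T.op_zero, ContinuousLinearMap.id_apply] at h1
  have h2 := (hasDerivAt_iff_tendsto_slope.1 h1).neg
  have h3 : Tendsto (fun h : ℝ≥0 => (h : ℝ)) (𝓝[>] 0) (𝓝[≠] 0) := by
    refine tendsto_nhdsWithin_iff.2 ⟨?_, ?_⟩
    · exact (NNReal.continuous_coe.tendsto 0).mono_left nhdsWithin_le_nhds
    · filter_upwards [self_mem_nhdsWithin] with h hh
      exact (NNReal.coe_pos.2 hh).ne'
  refine (h2.comp h3).congr fun h => ?_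
  have h4 := intervalIntegral.integral_Ioi_sub_Ioi (integrableOn_orbit hM hω hT y) h.coe_nonneg
  rw [op_integral_orbit hM hω hT]
  simp only [Function.comp_apply, slope, vsub_eq_sub, intervalIntegral.integral_same, sub_zero]
  rw [← Complex.ofReal_inv, Complex.coe_smul, ← smul_neg]
  congr 1
  rw [← h4, neg_sub]

/-- If `(A, C)` satisfies the Hautus test and `T` is exponentially stable, then `C T(t) x₀ = 0` for
almost all `t` only if `x₀ = 0`. On the largest closed `T`-invariant subspace `W` on which the
output vanishes, the resolvent of `A` extends to a bounded entire function: it is bounded on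
`Re s ≥ -ω/2` by stability, and it is `O(1 / |Re s|)` on `Re s < 0` by the Hautus test. By
Liouville's theorem it is zero, so `W = 0`. -/
theorem approximatelyObservable_of_hautusTest (hTA : T.Generates A)
    (hexp : T.ExponentiallyStable) (C : A.domain →ₗ[ℂ] Y) {K : ℝ}
    (hC : ∀ x, ‖C x‖ ≤ K * (‖(x : E)‖ + ‖A x‖)) (hH : HautusTest (fun x : E => ‖x‖) A C) :
    ApproximatelyObservable T hTA C := by
  obtain ⟨M, ω, hM1, hω, hT⟩ := hexp
  have hM : 0 ≤ M := zero_le_one.trans hM1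
  have hb := norm_op_le hM hω hT
  obtain ⟨R, hR⟩ := exists_integral_operator hM hω hT
  have hgen : ∀ y, T.HasGenerator (R y) (-y) := fun y => by
    rw [hR]
    exact hasGenerator_integral_orbit hM hω hT y
  have hmem : ∀ y, R y ∈ A.domain := fun y => hTA.mem_domain (hgen y)
  have hAR : ∀ y, A ⟨R y, hmem y⟩ = -y := fun y => hTA.apply_eq (hgen y)
  -- The bounded operator `L = C (-A)⁻¹`.
  obtain ⟨L, hL⟩ : ∃ L : E →L[ℂ] Y, ∀ y, L y = C ⟨R y, hmem y⟩ := by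
    refine ⟨LinearMap.mkContinuousOfExistsBound
      (C ∘ₗ (R : E →ₗ[ℂ] E).codRestrict A.domain hmem) ⟨|K| * (‖R‖ + 1), fun y => ?_⟩,
      fun y => rfl⟩
    refine (hC _).trans ?_
    change K * (‖R y‖ + ‖A ⟨R y, hmem y⟩‖) ≤ _
    rw [hAR, norm_neg]
    calc K * (‖R y‖ + ‖y‖) ≤ |K| * (‖R‖ * ‖y‖ + ‖y‖) := by
          gcongr
          · exact le_abs_self K
          · exact R.le_opNorm y
      _ = _ := by ring
  have hRA : ∀ x : A.domain, R (A x) = -x := fun x => by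
    have h1 : A (⟨R (A x), hmem _⟩ + x) = 0 := by rw [LinearPMap.map_add, hAR]; simp
    have h2 := norm_le_of_hasGenerator hM hT hω le_rfl
      (hTA.hasGenerator (⟨R (A x), hmem _⟩ + x)) (s := 0) (by simp)
    rw [h1] at h2
    rw [zero_smul, sub_zero, norm_zero, mul_zero] at h2
    exact eq_neg_of_add_eq_zero_left (norm_le_zero_iff.1 h2)
  intro x₀ hx₀
  rw [pos_iff_ne_zero]
  intro hzero
  apply hx₀
  have hCL : ∀ t : ℝ≥0, C ⟨T.op t x₀, hTA.op_mem t x₀.2⟩ = -L (T.op t (A x₀)) := fun t => by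
    rw [hL, ← map_neg]
    congr 1
    ext
    change T.op t x₀ = -R (T.op t (A x₀))
    rw [← hTA.apply_op, hRA]
    simp
  -- The largest closed `T`-invariant subspace on which `L` vanishes. It contains `A x₀`, and it is
  -- invariant under `R`, as `R y` is an integral over the orbit of `y`.
  set W : Submodule ℂ E := ⨅ t : ℝ≥0, LinearMap.ker ((L.comp (T.op t) : E →L[ℂ] Y) : E →ₗ[ℂ] Y)
    with hW
  have hWmem : ∀ y, y ∈ W ↔ ∀ t, L (T.op t y) = 0 := fun y => by
    simp [hW, Submodule.mem_iInf]
  have hWclosed : IsClosed (W : Set E) := by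
    rw [hW, Submodule.coe_iInf]
    exact isClosed_iInter fun t => ContinuousLinearMap.isClosed_ker (L.comp (T.op t))
  have hmemW : A x₀ ∈ W := by
    have hcont : Continuous fun t : ℝ => L (T.op t.toNNReal (A x₀)) :=
      L.continuous.comp (continuous_orbit_toNNReal hb _)
    simp only [hCL, enorm_neg] at hzero
    rw [lintegral_eq_zero_iff' (hcont.enorm.measurable.pow_const 2).aemeasurable] at hzero
    have hae : (fun t : ℝ => L (T.op t.toNNReal (A x₀))) =ᵐ[volume.restrict (Ioi 0)] 0 := by
      filter_upwards [hzero] with t ht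
      simpa using ht
    have hae' : (fun t : ℝ => L (T.op t.toNNReal (A x₀))) =ᵐ[volume.restrict (Ici 0)] 0 := by
      rwa [Measure.restrict_congr_set Ioi_ae_eq_Ici] at hae
    have heq := Measure.eqOn_of_ae_eq hae' hcont.continuousOn continuous_const.continuousOn
      (by rw [interior_Ici, closure_Ioi])
    refine (hWmem _).2 fun t => ?_
    have := heq (x := (t : ℝ)) t.2
    simpa using this
  have hRW : ∀ y ∈ W, R y ∈ W := fun y hy => by
    refine (hWmem _).2 fun t => ?_
    rw [hR, op_integral_orbit hM hω hT, ← L.integral_comp_comm]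
    · refine integral_eq_zero_of_ae (ae_of_all _ fun u => ?_)
      exact (hWmem y).1 hy _
    · exact (integrableOn_orbit hM hω hT y).mono_set (Ioi_subset_Ioi t.2)
  have : CompleteSpace W := hWclosed.completeSpace_coe
  obtain ⟨RW, hRW'⟩ : ∃ RW : W →L[ℂ] W, ∀ y : W, (RW y : E) = R y :=
    ⟨(R.comp W.subtypeL).codRestrict W fun y => hRW y y.2, fun y => rfl⟩
  obtain ⟨m, hm, hH⟩ := hH
  have hHW : ∀ s : ℂ, s.re < 0 → ∀ y : W, √m * |s.re| * ‖RW y‖ ≤ ‖y + s • RW y‖ :=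
      fun s hs y => by
    have h1 := hH s hs ⟨R y, hmem y⟩
    have h2 : C ⟨R y, hmem y⟩ = 0 := by
      rw [← hL]
      have := (hWmem y).1 y.2 0
      rwa [T.op_zero] at this
    rw [h2, hAR, norm_zero, sub_neg_eq_add] at h1
    have h3 : ‖y + s • RW y‖ = ‖s • R y + (y : E)‖ := by
      rw [Submodule.coe_norm, Submodule.coe_add, Submodule.coe_smul, hRW', add_comm]
    have h4 : ‖RW y‖ = ‖R y‖ := by rw [Submodule.coe_norm, hRW']
    rw [h3, h4]
    refine le_of_sq_le_sq ?_ (norm_nonneg _)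
    rw [mul_pow, mul_pow, Real.sq_sqrt hm.le]
    simpa using h1
  have hMpos : 0 < M := zero_lt_one.trans_le hM1
  have hres : ∀ s : ℂ, -(ω / 2) ≤ s.re → ∀ y : W, (ω / 2) / M * ‖RW y‖ ≤ ‖y + s • RW y‖ :=
      fun s hs y => by
    have h1 := norm_le_of_hasGenerator hM hT (half_pos hω) (half_le_self hω.le) (hgen y) (s := s)
      (by linarith)
    have h3 : ‖y + s • RW y‖ = ‖s • R y - -(y : E)‖ := by
      rw [Submodule.coe_norm, Submodule.coe_add, Submodule.coe_smul, hRW', add_comm,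
        sub_neg_eq_add]
    have h4 : ‖RW y‖ = ‖R y‖ := by rw [Submodule.coe_norm, hRW']
    rw [h3, h4, div_mul_eq_mul_div, div_le_iff₀ hMpos, mul_comm, mul_comm _ M]
    rwa [div_mul_eq_mul_div, le_div_iff₀ (half_pos hω)] at h1
  -- The constant of the Hautus test serves for `Re s < -ω/2`, where `|Re s| ≥ ω/2`.
  set c : ℝ := min (√m) (min (√m * (ω / 2)) ((ω / 2) / M))
  have hcpos : 0 < c := by
    have := Real.sqrt_pos.2 hm
    refine lt_min this (lt_min ?_ ?_) <;> positivity
  have hRW0 : RW = 0 := by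
    refine eq_zero_of_bounded_below RW hcpos (fun s y => ?_) fun s hs y => ?_
    · rcases le_or_gt (-(ω / 2)) s.re with hs | hs
      · refine le_trans ?_ (hres s hs y)
        gcongr
        exact (min_le_right _ _).trans (min_le_right _ _)
      · have hs0 : s.re < 0 := hs.trans (neg_lt_zero.2 (half_pos hω))
        refine le_trans ?_ (hHW s hs0 y)
        gcongr
        refine ((min_le_right _ _).trans (min_le_left _ _)).trans ?_
        gcongr
        rw [abs_of_neg hs0]
        linarith
    · refine le_trans ?_ (hHW s hs y)
      gcongr
      exact min_le_left _ _
  have hfin : (x₀ : E) = 0 := by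
    have h1 := hRA x₀
    have h2 := hRW' ⟨A x₀, hmemW⟩
    rw [hRW0, h1] at h2
    simpa using h2.symm
  exact Subtype.ext hfin

end C0Semigroup

/-! ### Absolutely continuous functions -/

namespace AbsolutelyContinuousOnInterval

variable {X X' X'' : Type*} [PseudoMetricSpace X] [PseudoMetricSpace X'] [PseudoMetricSpace X'']
  {a b : ℝ}

theorem of_dist_le {f : ℝ → X} {g : ℝ → X'} {h : ℝ → X''} (K : ℝ)
    (hf : AbsolutelyContinuousOnInterval f a b) (hg : AbsolutelyContinuousOnInterval g a b)
    (hle : ∀ x ∈ uIcc a b, ∀ y ∈ uIcc a b,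
      dist (h x) (h y) ≤ K * (dist (f x) (f y) + dist (g x) (g y))) :
    AbsolutelyContinuousOnInterval h a b := by
  unfold AbsolutelyContinuousOnInterval at hf hg
  refine squeeze_zero' ?_ ?_ (by simpa using (hf.add hg).const_mul K)
  · exact Eventually.of_forall fun _ => Finset.sum_nonneg fun i _ => dist_nonneg
  rw [eventually_inf_principal]
  refine Eventually.of_forall fun I hI => ?_
  rw [← Finset.sum_add_distrib, Finset.mul_sum]
  exact Finset.sum_le_sum fun i hi => hle _ (hI.1 i hi).1 _ (hI.1 i hi).2

variable {E E' : Type*} [NormedAddCommGroup E] [NormedAddCommGroup E']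

theorem clm_apply [NormedSpace ℂ E] [NormedSpace ℂ E'] {F : ℝ → E →L[ℂ] E'} {f : ℝ → E}
    (hF : AbsolutelyContinuousOnInterval F a b) (hf : AbsolutelyContinuousOnInterval f a b) :
    AbsolutelyContinuousOnInterval (fun t => F t (f t)) a b := by
  obtain ⟨C, hC⟩ := hF.exists_bound
  obtain ⟨D, hD⟩ := hf.exists_bound
  refine of_dist_le (C + D) hF hf fun x hx y hy => ?_
  have hC0 : 0 ≤ C := (norm_nonneg _).trans (hC x hx)
  have hD0 : 0 ≤ D := (norm_nonneg _).trans (hD x hx)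
  rw [dist_eq_norm, dist_eq_norm, dist_eq_norm]
  have h1 : F x (f x) - F y (f y) = F x (f x - f y) + (F x - F y) (f y) := by
    simp
  have h2 : ‖F x (f x - f y)‖ ≤ C * ‖f x - f y‖ := (F x).le_of_opNorm_le (hC x hx) _
  have h3 : ‖(F x - F y) (f y)‖ ≤ ‖F x - F y‖ * D :=
    (F x - F y).le_opNorm_of_le (hD y hy)
  rw [h1]
  refine (norm_add_le _ _).trans ?_
  nlinarith [mul_nonneg hC0 (norm_nonneg (F x - F y)), mul_nonneg hD0 (norm_nonneg (f x - f y))]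

theorem re_inner [InnerProductSpace ℂ E] {f g : ℝ → E}
    (hf : AbsolutelyContinuousOnInterval f a b) (hg : AbsolutelyContinuousOnInterval g a b) :
    AbsolutelyContinuousOnInterval (fun t => (inner ℂ (f t) (g t)).re) a b := by
  obtain ⟨C, hC⟩ := hf.exists_bound
  obtain ⟨D, hD⟩ := hg.exists_bound
  refine of_dist_le (C + D) hf hg fun x hx y hy => ?_
  have hC0 : 0 ≤ C := (norm_nonneg _).trans (hC x hx)
  have hD0 : 0 ≤ D := (norm_nonneg _).trans (hD x hx)
  rw [dist_eq_norm, dist_eq_norm, dist_eq_norm, ← Complex.sub_re]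
  have h1 : inner ℂ (f x) (g x) - inner ℂ (f y) (g y) =
      inner ℂ (f x) (g x - g y) + inner ℂ (f x - f y) (g y) := by
    rw [inner_sub_right, inner_sub_left]
    ring
  have h2 : ‖inner ℂ (f x) (g x - g y)‖ ≤ C * ‖g x - g y‖ :=
    (norm_inner_le_norm _ _).trans (by gcongr; exact hC x hx)
  have h3 : ‖inner ℂ (f x - f y) (g y)‖ ≤ ‖f x - f y‖ * D :=
    (norm_inner_le_norm _ _).trans (by gcongr; exact hD y hy)
  rw [h1]
  refine (Complex.abs_re_le_norm _).trans ((norm_add_le _ _).trans ?_)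
  nlinarith [mul_nonneg hC0 (norm_nonneg (f x - f y)), mul_nonneg hD0 (norm_nonneg (g x - g y))]

/-- An upper bound of the almost everywhere derivative bounds the increments from above. -/
theorem sub_le_integral {ψ g : ℝ → ℝ} (hψ : AbsolutelyContinuousOnInterval ψ 0 1)
    (hg : Integrable g unitMeasure)
    (hd : ∀ᵐ ζ ∂unitMeasure, ∃ d, HasDerivAt ψ d ζ ∧ d ≤ g ζ) {p q : ℝ} (hp : 0 ≤ p)
    (hpq : p ≤ q) (hq : q ≤ 1) : ψ q - ψ p ≤ ∫ ζ in p..q, g ζ := by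
  have hsub : uIcc p q ⊆ uIcc 0 1 := by
    rw [uIcc_of_le hpq, uIcc_of_le zero_le_one]
    exact Icc_subset_Icc hp hq
  have hψ' := hψ.mono hsub
  rw [← hψ'.integral_deriv_eq_sub]
  have hgi : IntervalIntegrable g volume p q := by
    rw [intervalIntegrable_iff_integrableOn_Icc_of_le hpq]
    exact IntegrableOn.mono_set (t := Icc 0 1) hg (Icc_subset_Icc hp hq)
  refine intervalIntegral.integral_mono_ae_restrict hpq hψ'.intervalIntegrable_deriv hgi ?_
  have := ae_restrict_of_ae_restrict_of_subset (Icc_subset_Icc hp hq) hd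
  filter_upwards [this] with ζ hζ
  obtain ⟨d, h1, h2⟩ := hζ
  rwa [h1.deriv]

/-- Gronwall's inequality for absolutely continuous functions. -/
theorem le_exp_mul {φ g : ℝ → ℝ} (hφ : AbsolutelyContinuousOnInterval φ 0 1) {a : ℝ} (ha : 0 ≤ a)
    (hg : Integrable g unitMeasure) (hg0 : ∀ ζ, 0 ≤ g ζ)
    (hd : ∀ᵐ ζ ∂unitMeasure, ∃ d, HasDerivAt φ d ζ ∧ d ≤ a * φ ζ + g ζ) {ζ : ℝ}
    (hζ : ζ ∈ Icc (0 : ℝ) 1) : φ ζ ≤ Real.exp (a * ζ) * (φ 0 + ∫ ζ, g ζ ∂unitMeasure) := by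
  have hexp : AbsolutelyContinuousOnInterval (fun ζ : ℝ => Real.exp (-a * ζ)) 0 1 := by
    have : ContDiff ℝ 1 fun ζ : ℝ => Real.exp (-a * ζ) := by fun_prop
    exact this.contDiffOn.absolutelyContinuousOnInterval
  have hmul : AbsolutelyContinuousOnInterval (fun ζ : ℝ => Real.exp (-a * ζ) * φ ζ) 0 1 :=
    hexp.fun_mul hφ
  have h1 := hmul.sub_le_integral hg (by
    have hmem : ∀ᵐ ζ ∂unitMeasure, ζ ∈ Icc (0 : ℝ) 1 := ae_restrict_mem measurableSet_Icc
    filter_upwards [hd, hmem] with ζ hζ hζm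
    obtain ⟨d, h1, h2⟩ := hζ
    have h3 : HasDerivAt (fun ζ : ℝ => -a * ζ) (-a * 1) ζ := (hasDerivAt_id ζ).const_mul _
    refine ⟨_, h3.exp.mul h1, ?_⟩
    have h4 : Real.exp (-a * ζ) ≤ 1 := Real.exp_le_one_iff.2 (by nlinarith [hζm.1])
    have h5 := Real.exp_pos (-a * ζ)
    nlinarith [hg0 ζ]) le_rfl hζ.1 hζ.2
  have h2 : ∫ ζ in (0 : ℝ)..ζ, g ζ ≤ ∫ ζ, g ζ ∂unitMeasure := by
    rw [intervalIntegral.integral_of_le hζ.1]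
    refine setIntegral_mono_set hg (ae_of_all _ hg0) (Eventually.of_forall fun x hx => ?_)
    exact ⟨hx.1.le, hx.2.trans hζ.2⟩
  have h3 : Real.exp (-a * ζ) * φ ζ ≤ φ 0 + ∫ ζ, g ζ ∂unitMeasure := by
    simp only [mul_zero, Real.exp_zero, one_mul] at h1
    linarith
  calc φ ζ = Real.exp (a * ζ) * (Real.exp (-a * ζ) * φ ζ) := by
        rw [← mul_assoc, ← Real.exp_add]
        simp
    _ ≤ _ := by gcongr

end AbsolutelyContinuousOnInterval

/-! ### Square integrable functions on the unit interval -/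

section L2

variable {n : ℕ}

theorem L2.integrable_norm_sq (x : L2 n) : Integrable (fun ζ => ‖x ζ‖ ^ 2) unitMeasure :=
  (Lp.memLp x).integrable_norm_pow two_ne_zero

theorem L2.norm_sq_eq (x : L2 n) : ‖x‖ ^ 2 = ∫ ζ, ‖x ζ‖ ^ 2 ∂unitMeasure := by
  have h1 : ((‖x‖ ^ 2 : ℝ) : ℂ) = inner ℂ x x := by
    rw [inner_self_eq_norm_sq_to_K]
    norm_cast
  rw [L2.inner_def] at h1
  have h2 : ∀ ζ, inner ℂ (x ζ) (x ζ) = ((‖x ζ‖ ^ 2 : ℝ) : ℂ) := fun ζ => by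
    rw [inner_self_eq_norm_sq_to_K]
    norm_cast
  simp only [h2] at h1
  rw [integral_complex_ofReal] at h1
  exact_mod_cast h1

theorem L2.norm_sq_le_of_ae_le {x : L2 n} {g : ℝ → ℝ} (hg : Integrable g unitMeasure)
    (h : ∀ᵐ ζ ∂unitMeasure, ‖x ζ‖ ^ 2 ≤ g ζ) : ‖x‖ ^ 2 ≤ ∫ ζ, g ζ ∂unitMeasure := by
  rw [L2.norm_sq_eq]
  exact integral_mono_ae (L2.integrable_norm_sq x) hg h

theorem L2.norm_sq_le_of_ae_norm_le {u x y : L2 n} {a b : ℝ}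
    (h : ∀ᵐ ζ ∂unitMeasure, ‖u ζ‖ ≤ a * ‖x ζ‖ + b * ‖y ζ‖) :
    ‖u‖ ^ 2 ≤ 2 * a ^ 2 * ‖x‖ ^ 2 + 2 * b ^ 2 * ‖y‖ ^ 2 := by
  have hx := (L2.integrable_norm_sq x).const_mul (2 * a ^ 2)
  have hy := (L2.integrable_norm_sq y).const_mul (2 * b ^ 2)
  rw [L2.norm_sq_eq x, L2.norm_sq_eq y, ← integral_const_mul, ← integral_const_mul,
    ← integral_add hx hy]
  refine L2.norm_sq_le_of_ae_le (hx.add hy) ?_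
  filter_upwards [h] with ζ hζ
  calc ‖u ζ‖ ^ 2 ≤ (a * ‖x ζ‖ + b * ‖y ζ‖) ^ 2 := by gcongr
    _ ≤ _ := by linarith [add_sq (a * ‖x ζ‖) (b * ‖y ζ‖), two_mul_le_add_sq (a * ‖x ζ‖) (b * ‖y ζ‖),
          mul_pow a ‖x ζ‖ 2, mul_pow b ‖y ζ‖ 2]

theorem hasDerivAt_norm_sq {w : ℝ → EuclideanSpace ℂ (Fin n)} {v : EuclideanSpace ℂ (Fin n)}
    {ζ : ℝ} (h : HasDerivAt w v ζ) :
    HasDerivAt (fun ζ => (inner ℂ (w ζ) (w ζ)).re) (2 * (inner ℂ (w ζ) v).re) ζ := by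
  have h1 := Complex.reCLM.hasFDerivAt.comp_hasDerivAt ζ (h.inner ℂ h)
  refine h1.congr_deriv ?_
  rw [Complex.reCLM_apply, Complex.add_re, ← inner_conj_symm v (w ζ), Complex.conj_re]
  ring

/-- The trace theorem: point values are bounded in the norm of `H¹`. The increments of `‖w‖²` are at
most `∫ 2 ‖w‖ ‖w'‖ ≤ ‖u‖² + ‖v‖²`, and the starting point is averaged over `[0, 1]`. -/
theorem IsH1Rep.norm_sq_le {u v : L2 n} {w : ℝ → EuclideanSpace ℂ (Fin n)} (h : IsH1Rep u v w)
    {b : ℝ} (hb : b ∈ Icc (0 : ℝ) 1) : ‖w b‖ ^ 2 ≤ 2 * ‖u‖ ^ 2 + ‖v‖ ^ 2 := by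
  set ψ : ℝ → ℝ := fun ζ => (inner ℂ (w ζ) (w ζ)).re
  have hψn : ∀ ζ, ψ ζ = ‖w ζ‖ ^ 2 := fun ζ => inner_self_eq_norm_sq (𝕜 := ℂ) (w ζ)
  have hac : AbsolutelyContinuousOnInterval ψ 0 1 := h.absCont.re_inner h.absCont
  set g : ℝ → ℝ := fun ζ => ‖u ζ‖ ^ 2 + ‖v ζ‖ ^ 2 with hg
  have hgi : Integrable g unitMeasure := (L2.integrable_norm_sq u).add (L2.integrable_norm_sq v)
  have hgint : ∫ ζ, g ζ ∂unitMeasure = ‖u‖ ^ 2 + ‖v‖ ^ 2 := by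
    rw [L2.norm_sq_eq, L2.norm_sq_eq]
    exact integral_add (L2.integrable_norm_sq u) (L2.integrable_norm_sq v)
  have hg0 : ∀ ζ, 0 ≤ g ζ := fun ζ => by positivity
  have hder : ∀ᵐ ζ ∂unitMeasure, HasDerivAt ψ (2 * (inner ℂ (w ζ) (v ζ)).re) ζ ∧
      |2 * (inner ℂ (w ζ) (v ζ)).re| ≤ g ζ := by
    filter_upwards [h.hasDeriv, h.ae_eq] with ζ h1 h2
    refine ⟨hasDerivAt_norm_sq h1, ?_⟩
    have h3 := (Complex.abs_re_le_norm (inner ℂ (w ζ) (v ζ))).trans (norm_inner_le_norm _ _)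
    simp only [abs_mul, abs_two, hg, h2]
    nlinarith [sq_nonneg (‖w ζ‖ - ‖v ζ‖)]
  have hint : ∀ p q, 0 ≤ p → p ≤ q → q ≤ 1 → ∫ ζ in p..q, g ζ ≤ ‖u‖ ^ 2 + ‖v‖ ^ 2 := by
    intro p q hp hpq hq
    rw [intervalIntegral.integral_of_le hpq, ← hgint]
    refine setIntegral_mono_set hgi (ae_of_all _ hg0) (Eventually.of_forall fun x hx => ?_)
    exact ⟨hp.trans hx.1.le, hx.2.trans hq⟩
  have hle : ∀ ζ ∈ Icc (0 : ℝ) 1, ‖w b‖ ^ 2 ≤ ‖w ζ‖ ^ 2 + (‖u‖ ^ 2 + ‖v‖ ^ 2) := fun ζ hζ => by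
    rw [← hψn, ← hψn]
    rcases le_total ζ b with hζb | hζb
    · have := hac.sub_le_integral hgi
        (hder.mono fun ζ h => ⟨_, h.1, (le_abs_self _).trans h.2⟩) hζ.1 hζb hb.2
      linarith [hint ζ b hζ.1 hζb hb.2]
    · have := hac.neg.sub_le_integral hgi
        (hder.mono fun ζ h => ⟨_, h.1.neg, (neg_le_abs _).trans h.2⟩) hb.1 hζb hζ.2
      simp only [Pi.neg_apply] at this
      linarith [hint b ζ hb.1 hζb hζ.2]
  have hprob : IsProbabilityMeasure unitMeasure := ⟨by simp⟩
  have hmem : ∀ᵐ ζ ∂unitMeasure, ζ ∈ Icc (0 : ℝ) 1 := ae_restrict_mem measurableSet_Icc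
  have hfin : ∫ _, ‖w b‖ ^ 2 ∂unitMeasure ≤ ∫ ζ, (‖u ζ‖ ^ 2 + (‖u‖ ^ 2 + ‖v‖ ^ 2)) ∂unitMeasure := by
    refine integral_mono_ae (integrable_const _)
      ((L2.integrable_norm_sq u).add (integrable_const _)) ?_
    filter_upwards [h.ae_eq, hmem] with ζ h1 h2
    rw [h1]
    exact hle ζ h2
  rw [integral_add (L2.integrable_norm_sq u) (integrable_const _), ← L2.norm_sq_eq,
    integral_const, integral_const] at hfin
  simp only [probReal_univ, one_smul] at hfin
  linarith

end L2

/-! ### Matrices as operators on Euclidean space -/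

section MatrixOperators

variable {n : ℕ}

/-- The operator on the Euclidean space `ℂⁿ` given by the matrix `M`. -/
noncomputable abbrev matrixCLM (M : Matrix (Fin n) (Fin n) ℂ) :
    EuclideanSpace ℂ (Fin n) →L[ℂ] EuclideanSpace ℂ (Fin n) :=
  Matrix.toEuclideanCLM (𝕜 := ℂ) M

theorem matrixCLM_eq_sum (M : Matrix (Fin n) (Fin n) ℂ) :
    matrixCLM M = ∑ i, ∑ j, M i j • matrixCLM (Matrix.single i j 1) := by
  conv_lhs => rw [Matrix.matrix_eq_sum_single M]
  simp only [matrixCLM, map_sum, ← map_smul, Matrix.smul_single, smul_eq_mul, mul_one]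

theorem ae_norm_le_of_memLp_top {f : ℝ → ℂ} {μ : Measure ℝ} (hf : MemLp f ∞ μ) :
    ∀ᵐ ζ ∂μ, ‖f ζ‖ ≤ (eLpNorm f ∞ μ).toReal := by
  have hfin : eLpNorm f ∞ μ ≠ ∞ := hf.2.ne
  have h : ∀ᵐ ζ ∂μ, ‖f ζ‖ₑ ≤ eLpNorm f ∞ μ := by
    rw [eLpNorm_exponent_top]
    exact ae_le_eLpNormEssSup
  filter_upwards [h] with ζ hζ
  rw [← toReal_enorm]
  exact ENNReal.toReal_mono hfin hζ

theorem exists_norm_matrixCLM_le_of_memLp {M : ℝ → Matrix (Fin n) (Fin n) ℂ}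
    (hM : ∀ i j, MemLp (fun ζ => M ζ i j) ∞ unitMeasure) :
    ∃ K, 0 < K ∧ ∀ᵐ ζ ∂unitMeasure, ‖matrixCLM (M ζ)‖ ≤ K := by
  have hb : ∀ i j, ∃ c : ℝ, ∀ᵐ ζ ∂unitMeasure, ‖M ζ i j‖ ≤ c := fun i j =>
    ⟨_, ae_norm_le_of_memLp_top (hM i j)⟩
  choose c hc using hb
  refine ⟨max 1 (∑ i, ∑ j, c i j * ‖matrixCLM (Matrix.single i j (1 : ℂ) :
    Matrix (Fin n) (Fin n) ℂ)‖), lt_max_of_lt_left one_pos, ?_⟩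
  filter_upwards [ae_all_iff.2 fun i => ae_all_iff.2 fun j => hc i j] with ζ hζ
  refine le_max_of_le_right ?_
  rw [matrixCLM_eq_sum]
  refine (norm_sum_le _ _).trans (Finset.sum_le_sum fun i _ => ?_)
  refine (norm_sum_le _ _).trans (Finset.sum_le_sum fun j _ => ?_)
  rw [norm_smul]
  gcongr
  exact hζ i j

theorem contDiffOn_matrixCLM {S : ℝ → Matrix (Fin n) (Fin n) ℂ} {s : Set ℝ}
    (hS : ∀ i j, ContDiffOn ℝ 1 (fun ζ => S ζ i j) s) :
    ContDiffOn ℝ 1 (fun ζ => matrixCLM (S ζ)) s := by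
  simp only [fun ζ => matrixCLM_eq_sum (S ζ)]
  exact ContDiffOn.sum fun i _ => ContDiffOn.sum fun j _ => (hS i j).smul contDiffOn_const

theorem inner_matrixCLM_of_isHermitian {M : Matrix (Fin n) (Fin n) ℂ} (hM : M.IsHermitian)
    (x y : EuclideanSpace ℂ (Fin n)) :
    inner ℂ (matrixCLM M x) y = inner ℂ x (matrixCLM M y) :=
  Matrix.isSymmetric_toEuclideanLin_iff.2 hM x y

theorem im_inner_matrixCLM_of_isHermitian {M : Matrix (Fin n) (Fin n) ℂ} (hM : M.IsHermitian)
    (x : EuclideanSpace ℂ (Fin n)) : (inner ℂ (matrixCLM M x) x).im = 0 := by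
  rw [← Complex.conj_eq_iff_im, inner_conj_symm, inner_matrixCLM_of_isHermitian hM]

theorem norm_inner_matrixCLM_le {M : Matrix (Fin n) (Fin n) ℂ} {K : ℝ} (hK : ‖matrixCLM M‖ ≤ K)
    (x y : EuclideanSpace ℂ (Fin n)) : ‖inner ℂ x (matrixCLM M y)‖ ≤ K * ‖x‖ * ‖y‖ := by
  refine (norm_inner_le_norm _ _).trans ?_
  calc ‖x‖ * ‖matrixCLM M y‖ ≤ ‖x‖ * (K * ‖y‖) := by
        gcongr
        exact (matrixCLM M).le_of_opNorm_le hK y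
    _ = _ := by ring

theorem matrixCLM_mul_apply (M N : Matrix (Fin n) (Fin n) ℂ) (x : EuclideanSpace ℂ (Fin n)) :
    matrixCLM (M * N) x = matrixCLM M (matrixCLM N x) := by
  simp [matrixCLM]

theorem matrixCLM_inv_apply {M : Matrix (Fin n) (Fin n) ℂ} (hM : IsUnit M)
    (x : EuclideanSpace ℂ (Fin n)) : matrixCLM M⁻¹ (matrixCLM M x) = x := by
  rw [← matrixCLM_mul_apply, Matrix.nonsing_inv_mul _ ((Matrix.isUnit_iff_isUnit_det _).1 hM)]
  simp [matrixCLM]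

theorem matrixCLM_apply_inv {M : Matrix (Fin n) (Fin n) ℂ} (hM : IsUnit M)
    (x : EuclideanSpace ℂ (Fin n)) : matrixCLM M (matrixCLM M⁻¹ x) = x := by
  rw [← matrixCLM_mul_apply, Matrix.mul_nonsing_inv _ ((Matrix.isUnit_iff_isUnit_det _).1 hM)]
  simp [matrixCLM]

/-- A positive definite matrix whose inverse has norm at most `K` is bounded below by `K⁻¹`. -/
theorem Matrix.PosDef.inv_mul_norm_sq_le {M : Matrix (Fin n) (Fin n) ℂ} (hM : M.PosDef) {K : ℝ}
    (hK0 : 0 < K) (hK : ‖matrixCLM M⁻¹‖ ≤ K) (x : EuclideanSpace ℂ (Fin n)) :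
    K⁻¹ * ‖x‖ ^ 2 ≤ (inner ℂ (matrixCLM M x) x).re := by
  set a : ℂ := ((K⁻¹ : ℝ) : ℂ) with ha
  set p := matrixCLM M⁻¹ x
  have hMp : matrixCLM M p = x := matrixCLM_apply_inv hM.isUnit x
  -- Positivity of the form at `x - K⁻¹ M⁻¹ x`.
  have h0 : 0 ≤ (inner ℂ (matrixCLM M (x - a • p)) (x - a • p)).re :=
    (Matrix.isPositive_toEuclideanLin_iff.2 hM.posSemidef).re_inner_nonneg_left _
  have h1 : inner ℂ (matrixCLM M x) p = inner ℂ x x := by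
    rw [inner_matrixCLM_of_isHermitian hM.isHermitian, hMp]
  have h2 : (inner ℂ x p).re ≤ K * ‖x‖ ^ 2 := by
    refine (Complex.re_le_norm _).trans ((norm_inner_matrixCLM_le hK x x).trans_eq ?_)
    ring
  have h3 : (inner ℂ x x).re = ‖x‖ ^ 2 := inner_self_eq_norm_sq (𝕜 := ℂ) x
  rw [map_sub, map_smul, hMp, inner_sub_left, inner_sub_right, inner_sub_right, inner_smul_left,
    inner_smul_left, inner_smul_right, inner_smul_right, h1, ha, Complex.conj_ofReal] at h0
  simp only [Complex.sub_re, Complex.re_ofReal_mul, h3] at h0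
  have h4 : K⁻¹ * (K⁻¹ * (inner ℂ x p).re) ≤ K⁻¹ * (K⁻¹ * (K * ‖x‖ ^ 2)) := by gcongr
  rw [inv_mul_cancel_left₀ hK0.ne'] at h4
  linarith

/-- The eigenvalues of the product `P H` of a Hermitian and a positive definite matrix are real:
with `G = S⁻ᴴ H S⁻¹`, the matrix `G Δ = S⁻ᴴ (H P H) S⁻¹` is Hermitian, and the diagonal entries of
`G` are positive. -/
theorem isHermitian_diagonal_of_mul_posDef {P H S : Matrix (Fin n) (Fin n) ℂ} {d : Fin n → ℂ}
    (hP : P.IsHermitian) (hH : H.PosDef) (hS : IsUnit S)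
    (h : P * H = S⁻¹ * Matrix.diagonal d * S) : (Matrix.diagonal d).IsHermitian := by
  have hdet := (Matrix.isUnit_iff_isUnit_det _).1 hS
  set G := (S⁻¹).conjTranspose * H * S⁻¹ with hG
  have hGpos : G.PosDef := hH.conjTranspose_mul_mul_same <|
    Matrix.mulVec_injective_of_isUnit (Matrix.isUnit_nonsing_inv_iff.2 hS)
  have hGd : G * Matrix.diagonal d = (S⁻¹).conjTranspose * (H.conjTranspose * P * H) * S⁻¹ := by
    rw [hH.isHermitian.eq, mul_assoc H, h, hG]
    simp only [mul_assoc]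
    rw [Matrix.mul_nonsing_inv _ hdet, mul_one]
  have hherm : (G * Matrix.diagonal d).IsHermitian := by
    rw [hGd]
    exact Matrix.isHermitian_conjTranspose_mul_mul _ (Matrix.isHermitian_conjTranspose_mul_mul _ hP)
  refine Matrix.isHermitian_diagonal_iff.2 fun i => ?_
  have h1 := hherm.apply i i
  rw [Matrix.mul_diagonal, star_mul, hGpos.isHermitian.apply i i, mul_comm] at h1
  exact mul_left_cancel₀ hGpos.diag_pos.ne' h1

theorem two_mul_le_mul_sq_add {τ : ℝ} (hτ : 0 < τ) (K a b : ℝ) :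
    2 * (K * a * b) ≤ τ * a ^ 2 + K ^ 2 / τ * b ^ 2 := by
  have h : 0 ≤ (τ * a - K * b) ^ 2 / τ := by positivity
  have h' : (τ * a - K * b) ^ 2 / τ = τ * a ^ 2 + K ^ 2 / τ * b ^ 2 - 2 * (K * a * b) := by
    field_simp
    ring
  linarith

/-- The pointwise estimate behind the Gronwall argument in the characteristic coordinates
`y = S P w`, where `w = H x` and `P v = s x - z - G w`. In `⟨y, S P v⟩` the term `s x` contributes
`s ⟨d S x, S x⟩`, and `Im s` drops out of its real part because the diagonal matrix `d` is real. -/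
theorem two_mul_re_inner_characteristic_le {P H S G : Matrix (Fin n) (Fin n) ℂ} {d : Fin n → ℂ}
    {F' : EuclideanSpace ℂ (Fin n) →L[ℂ] EuclideanSpace ℂ (Fin n)} {Kd Ke Kg Ks Kw Kx ρ : ℝ}
    (hP : P.IsHermitian) (hH : H.PosDef) (hS : IsUnit S)
    (h : P * H = S⁻¹ * Matrix.diagonal d * S) (hKd0 : 0 ≤ Kd) (hKe0 : 0 ≤ Ke) (hKg0 : 0 ≤ Kg)
    (hKs0 : 0 ≤ Ks) (hKx0 : 0 ≤ Kx)
    (hKd : ‖matrixCLM (Matrix.diagonal d)‖ ≤ Kd) (hKe : ‖F'‖ ≤ Ke) (hKg : ‖matrixCLM G‖ ≤ Kg)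
    (hKs : ‖matrixCLM S‖ ≤ Ks) {s : ℂ} (hs : |s.re| ≤ ρ) {x z v w y : EuclideanSpace ℂ (Fin n)}
    (hw : w = matrixCLM H x) (hv : matrixCLM P v = s • x - z - matrixCLM G w)
    (hy : y = matrixCLM (S * P) w) (hwy : ‖w‖ ≤ Kw * ‖y‖) (hxy : ‖x‖ ≤ Kx * ‖y‖) :
    2 * (inner ℂ y (F' w + matrixCLM (S * P) v)).re ≤
      (2 * (ρ * (Kd * (Ks * Kx) ^ 2)) + 2 * (Ke * Kw) + 2 * (Ks * Kg * Kw) + 1) * ‖y‖ ^ 2 +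
        Ks ^ 2 * ‖z‖ ^ 2 := by
  obtain ⟨q, hq⟩ : ∃ q, q = matrixCLM S x := ⟨_, rfl⟩
  have hyq : y = matrixCLM (Matrix.diagonal d) q := by
    rw [hy, hq, hw, matrixCLM_mul_apply, ← matrixCLM_mul_apply P, h, mul_assoc,
      matrixCLM_mul_apply, matrixCLM_apply_inv hS, matrixCLM_mul_apply]
  have hFv : matrixCLM (S * P) v = s • q - matrixCLM S z - matrixCLM S (matrixCLM G w) := by
    rw [matrixCLM_mul_apply, hv, map_sub, map_sub, map_smul, hq]
  have hherm := isHermitian_diagonal_of_mul_posDef hP hH hS h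
  have hqn : ‖q‖ ≤ Ks * Kx * ‖y‖ := by
    rw [hq, mul_assoc]
    exact (ContinuousLinearMap.le_of_opNorm_le _ hKs _).trans (by gcongr)
  have hsq : (inner ℂ y (s • q)).re ≤ ρ * (Kd * (Ks * Kx) ^ 2) * ‖y‖ ^ 2 := by
    have him : (inner ℂ y q).im = 0 := by
      rw [hyq]
      exact im_inner_matrixCLM_of_isHermitian hherm q
    rw [inner_smul_right, Complex.mul_re, him, mul_zero, sub_zero]
    have hyqn : |(inner ℂ y q).re| ≤ Kd * (Ks * Kx) ^ 2 * ‖y‖ ^ 2 := by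
      have h1 : inner ℂ y q = inner ℂ q (matrixCLM (Matrix.diagonal d) q) := by
        rw [hyq, inner_matrixCLM_of_isHermitian hherm]
      rw [h1]
      refine (Complex.abs_re_le_norm _).trans ((norm_inner_matrixCLM_le hKd _ _).trans ?_)
      calc Kd * ‖q‖ * ‖q‖ ≤ Kd * (Ks * Kx * ‖y‖) * (Ks * Kx * ‖y‖) := by gcongr
        _ = _ := by ring
    refine (le_abs_self _).trans ?_
    rw [abs_mul, mul_assoc]
    exact mul_le_mul hs hyqn (abs_nonneg _) ((abs_nonneg _).trans hs)
  have hbound : ∀ (p : EuclideanSpace ℂ (Fin n)) (B : ℝ), ‖p‖ ≤ B →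
      |(inner ℂ y p).re| ≤ ‖y‖ * B := fun p B hp =>
    (Complex.abs_re_le_norm _).trans ((norm_inner_le_norm _ _).trans (by gcongr))
  have e1 := le_of_abs_le <| hbound (F' w) (Ke * (Kw * ‖y‖)) <|
    (F'.le_of_opNorm_le hKe _).trans (by gcongr)
  have e2 := neg_le_of_abs_le <| hbound (matrixCLM S z) (Ks * ‖z‖) <|
    ContinuousLinearMap.le_of_opNorm_le _ hKs _
  have e3 := neg_le_of_abs_le <| hbound (matrixCLM S (matrixCLM G w)) (Ks * (Kg * (Kw * ‖y‖))) <|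
    (ContinuousLinearMap.le_of_opNorm_le _ hKs _).trans (by
      gcongr
      exact (ContinuousLinearMap.le_of_opNorm_le _ hKg _).trans (by gcongr))
  have e4 := two_mul_le_add_sq ‖y‖ (Ks * ‖z‖)
  rw [mul_pow] at e4
  rw [hFv, inner_add_right, inner_sub_right, inner_sub_right, Complex.add_re, Complex.sub_re,
    Complex.sub_re]
  linarith

end MatrixOperators

/-! ### The operators of a port-Hamiltonian system -/

namespace PortHamiltonianSystem

variable {n : ℕ} (𝒮 : PortHamiltonianSystem n)

theorem opH_ae_eq (x : L2 n) :
    ∀ᵐ ζ ∂unitMeasure, 𝒮.opH x ζ = matrixCLM (𝒮.ℋ ζ) (x ζ) :=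
  (memLp_mulVec 𝒮.memLp_ℋ x).coeFn_toLp

theorem constOp_ae_eq (M : Matrix (Fin n) (Fin n) ℂ) (x : L2 n) :
    ∀ᵐ ζ ∂unitMeasure, constOp M x ζ = matrixCLM M (x ζ) :=
  (memLp_mulVec (fun i j => memLp_top_const (M i j)) x).coeFn_toLp

/-- The operators `A` and `C` in terms of the continuous representative `w` of `ℋ x` and its
derivative `v`. -/
theorem exists_isH1Rep (x : 𝒮.A.domain) :
    ∃ v w, IsH1Rep (𝒮.opH x) v w ∧
      matrixCLM 𝒮.W_B₁ (w 1) + matrixCLM 𝒮.W_B₀ (w 0) = 0 ∧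
      𝒮.C x = matrixCLM 𝒮.W_C₁ (w 1) + matrixCLM 𝒮.W_C₀ (w 0) ∧
      ∀ᵐ ζ ∂unitMeasure, w ζ = matrixCLM (𝒮.ℋ ζ) ((x : L2 n) ζ) ∧ HasDerivAt w (v ζ) ζ ∧
        𝒮.A x ζ = matrixCLM 𝒮.P₁ (v ζ) + matrixCLM 𝒮.G₀ (w ζ) := by
  obtain ⟨hx, hB⟩ := x.2
  have hrep := hx.choose_spec.choose_spec
  refine ⟨_, _, hrep, hB, rfl, ?_⟩
  have hA : 𝒮.A x = constOp 𝒮.P₁ hx.choose + constOp 𝒮.G₀ (𝒮.opH x) := rfl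
  filter_upwards [hrep.ae_eq, hrep.hasDeriv, 𝒮.opH_ae_eq x, constOp_ae_eq 𝒮.P₁ hx.choose,
    constOp_ae_eq 𝒮.G₀ (𝒮.opH x), Lp.coeFn_add (constOp 𝒮.P₁ hx.choose)
      (constOp 𝒮.G₀ (𝒮.opH x))] with ζ h1 h2 h3 h4 h5 h6
  refine ⟨by rw [← h1, h3], h2, ?_⟩
  rw [hA, h6, Pi.add_apply, h4, h5, h1]

/-- As `W_BC` is invertible and `[W_{B,1} W_{B,0}]` annihilates the boundary values of `ℋ x`, these
are determined by the output `C x`. -/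
theorem exists_boundary_bound (hW : IsUnit 𝒮.W_BC) :
    ∃ K, 0 < K ∧ ∀ w₁ w₀ : EuclideanSpace ℂ (Fin n),
      matrixCLM 𝒮.W_B₁ w₁ + matrixCLM 𝒮.W_B₀ w₀ = 0 →
      ‖w₁‖ ≤ K * ‖matrixCLM 𝒮.W_C₁ w₁ + matrixCLM 𝒮.W_C₀ w₀‖ ∧
      ‖w₀‖ ≤ K * ‖matrixCLM 𝒮.W_C₁ w₁ + matrixCLM 𝒮.W_C₀ w₀‖ := by
  obtain ⟨V, hV⟩ : ∃ V, V * 𝒮.W_BC = 1 :=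
    ⟨_, Matrix.nonsing_inv_mul _ ((Matrix.isUnit_iff_isUnit_det _).1 hW)⟩
  rw [← Matrix.fromBlocks_toBlocks V, W_BC, Matrix.fromBlocks_multiply, ← Matrix.fromBlocks_one,
    Matrix.fromBlocks_inj] at hV
  obtain ⟨h11, h10, h01, h00⟩ := hV
  refine ⟨max 1 (max ‖matrixCLM V.toBlocks₁₂‖ ‖matrixCLM V.toBlocks₂₂‖),
    lt_max_of_lt_left one_pos, fun w₁ w₀ hB => ?_⟩
  have key : ∀ M N p q : Matrix (Fin n) (Fin n) ℂ, M * 𝒮.W_B₁ + N * 𝒮.W_C₁ = p →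
      M * 𝒮.W_B₀ + N * 𝒮.W_C₀ = q → matrixCLM p w₁ + matrixCLM q w₀ =
        matrixCLM N (matrixCLM 𝒮.W_C₁ w₁ + matrixCLM 𝒮.W_C₀ w₀) := by
    rintro M N p q rfl rfl
    have h1 : matrixCLM M (matrixCLM 𝒮.W_B₁ w₁ + matrixCLM 𝒮.W_B₀ w₀) = 0 := by rw [hB, map_zero]
    rw [map_add, ← matrixCLM_mul_apply, ← matrixCLM_mul_apply] at h1 ⊢
    simp only [matrixCLM, map_add, add_apply] at h1 ⊢
    rw [← sub_eq_zero, ← h1]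
    abel
  have k1 := key _ _ _ _ h11 h10
  have k0 := key _ _ _ _ h01 h00
  simp only [matrixCLM, map_one, map_zero, one_apply_eq_self,
    zero_apply, add_zero, zero_add] at k1 k0
  constructor
  · conv_lhs => rw [k1]
    exact ContinuousLinearMap.le_of_opNorm_le _ (le_max_of_le_right (le_max_left _ _)) _
  · conv_lhs => rw [k0]
    exact ContinuousLinearMap.le_of_opNorm_le _ (le_max_of_le_right (le_max_right _ _)) _

theorem coeFn_smul_sub (s : ℂ) (x y : L2 n) :
    ∀ᵐ ζ ∂unitMeasure, (s • x - y) ζ = s • x ζ - y ζ := by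
  filter_upwards [Lp.coeFn_sub (s • x) y, Lp.coeFn_smul s x] with ζ h1 h2
  rw [h1, Pi.sub_apply, h2, Pi.smul_apply]

/-- The output is bounded in the graph norm of `A`. -/
theorem exists_norm_C_le :
    ∃ K, ∀ x : 𝒮.A.domain, ‖𝒮.C x‖ ≤ K * (‖(x : L2 n)‖ + ‖𝒮.A x‖) := by
  obtain ⟨K, hK0, hK⟩ := exists_norm_matrixCLM_le_of_memLp 𝒮.memLp_ℋ
  set Kp := ‖matrixCLM (𝒮.P₁)⁻¹‖
  set Kg := ‖matrixCLM 𝒮.G₀‖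
  set c : ℝ := 4 * K ^ 2 + 2 * Kp ^ 2 + 2 * (Kp * (Kg * K)) ^ 2 with hc
  have hc0 : 0 ≤ c := by positivity
  refine ⟨(‖matrixCLM 𝒮.W_C₁‖ + ‖matrixCLM 𝒮.W_C₀‖) * √c, fun x => ?_⟩
  obtain ⟨v, w, hrep, -, hC, hae⟩ := 𝒮.exists_isH1Rep x
  have hw : ∀ᵐ ζ ∂unitMeasure, ‖w ζ‖ ≤ 0 * ‖𝒮.A x ζ‖ + K * ‖(x : L2 n) ζ‖ := by
    filter_upwards [hae, hK] with ζ h1 h2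
    rw [h1.1, zero_mul, zero_add]
    exact (matrixCLM _).le_of_opNorm_le h2 _
  have hu := L2.norm_sq_le_of_ae_norm_le (u := 𝒮.opH x) (x := 𝒮.A x) (y := x) (by
    filter_upwards [hw, hrep.ae_eq] with ζ h1 h2
    rw [h2]
    exact h1)
  have hv := L2.norm_sq_le_of_ae_norm_le (u := v) (x := 𝒮.A x) (y := x)
      (a := Kp) (b := Kp * (Kg * K)) (by
    filter_upwards [hae, hw] with ζ h1 h2
    have h4 : v ζ = matrixCLM (𝒮.P₁)⁻¹ (𝒮.A x ζ - matrixCLM 𝒮.G₀ (w ζ)) := by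
      rw [h1.2.2, add_sub_cancel_right, matrixCLM_inv_apply 𝒮.isUnit_P₁]
    have h5 : ‖matrixCLM 𝒮.G₀ (w ζ)‖ ≤ Kg * (K * ‖(x : L2 n) ζ‖) :=
      ContinuousLinearMap.le_opNorm_of_le _ (by linarith)
    rw [h4]
    refine (ContinuousLinearMap.le_opNorm_of_le _ ((norm_sub_le _ _).trans
      (add_le_add_right h5 _))).trans_eq ?_
    ring)
  have hwb : ∀ b ∈ Icc (0 : ℝ) 1, ‖w b‖ ≤ √c * (‖(x : L2 n)‖ + ‖𝒮.A x‖) := fun b hb => by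
    have h1 := hrep.norm_sq_le hb
    have hr0 : 0 ≤ ‖(x : L2 n)‖ := norm_nonneg _
    have hq0 : 0 ≤ ‖𝒮.A x‖ := norm_nonneg _
    clear hae hw hrep hC hK
    clear_value Kp Kg
    revert h1 hr0 hq0 hu hv
    generalize ‖(x : L2 n)‖ = r
    generalize ‖𝒮.A x‖ = q
    intro hu hv h1 hr0 hq0
    refine le_of_sq_le_sq ?_ (mul_nonneg (Real.sqrt_nonneg c) (add_nonneg hr0 hq0))
    rw [mul_pow, Real.sq_sqrt hc0]
    have h3 : 0 ≤ K ^ 2 * q ^ 2 := by positivity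
    have h4 : 0 ≤ Kp ^ 2 * r ^ 2 := by positivity
    have h5 : 0 ≤ (Kp * (Kg * K)) ^ 2 * q ^ 2 := by positivity
    have hr : 0 ≤ r * q := mul_nonneg hr0 hq0
    calc ‖w b‖ ^ 2 ≤ c * (r ^ 2 + q ^ 2) := by
          rw [hc]
          linarith
      _ ≤ c * (r + q) ^ 2 := by
          refine mul_le_mul_of_nonneg_left ?_ hc0
          linarith [add_sq r q]
  rw [hC]
  refine (norm_add_le _ _).trans ?_
  calc ‖matrixCLM 𝒮.W_C₁ (w 1)‖ + ‖matrixCLM 𝒮.W_C₀ (w 0)‖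
      ≤ ‖matrixCLM 𝒮.W_C₁‖ * (√c * (‖(x : L2 n)‖ + ‖𝒮.A x‖)) +
        ‖matrixCLM 𝒮.W_C₀‖ * (√c * (‖(x : L2 n)‖ + ‖𝒮.A x‖)) := by
        gcongr
        · exact ContinuousLinearMap.le_opNorm_of_le _ (hwb 1 (right_mem_Icc.2 zero_le_one))
        · exact ContinuousLinearMap.le_opNorm_of_le _ (hwb 0 (left_mem_Icc.2 zero_le_one))
    _ = _ := by ring

/-- The energy norm is equivalent to the norm of `L²(0, 1; ℂⁿ)`. -/
theorem exists_energyNorm_bounds :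
    ∃ a b : ℝ, 0 < a ∧ 0 < b ∧ ∀ x : L2 n,
      a * ‖x‖ ^ 2 ≤ 𝒮.energyNorm x ^ 2 ∧ 𝒮.energyNorm x ^ 2 ≤ b * ‖x‖ ^ 2 := by
  obtain ⟨K, hK0, hK⟩ := exists_norm_matrixCLM_le_of_memLp 𝒮.memLp_ℋ
  obtain ⟨K', hK'0, hK'⟩ := exists_norm_matrixCLM_le_of_memLp 𝒮.memLp_ℋ_inv
  refine ⟨K'⁻¹, K, inv_pos.2 hK'0, hK0, fun x => ?_⟩
  have hint : Integrable (fun ζ => (inner ℂ (x ζ) (𝒮.opH x ζ)).re) unitMeasure :=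
    (L2.integrable_inner (𝕜 := ℂ) x (𝒮.opH x)).re
  have heq : (inner ℂ x (𝒮.opH x)).re = ∫ ζ, (inner ℂ (x ζ) (𝒮.opH x ζ)).re ∂unitMeasure := by
    rw [L2.inner_def]
    exact (integral_re (L2.integrable_inner (𝕜 := ℂ) x (𝒮.opH x))).symm
  have hlow : K'⁻¹ * ‖x‖ ^ 2 ≤ (inner ℂ x (𝒮.opH x)).re := by
    rw [heq, L2.norm_sq_eq, ← integral_const_mul]
    refine integral_mono_ae ((L2.integrable_norm_sq _).const_mul _) hint ?_
    filter_upwards [𝒮.opH_ae_eq x, hK', 𝒮.posDef_ℋ] with ζ h1 h2 h3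
    rw [h1, ← inner_matrixCLM_of_isHermitian h3.isHermitian]
    exact h3.inv_mul_norm_sq_le hK'0 h2 _
  have hup : (inner ℂ x (𝒮.opH x)).re ≤ K * ‖x‖ ^ 2 := by
    rw [heq, L2.norm_sq_eq, ← integral_const_mul]
    refine integral_mono_ae hint ((L2.integrable_norm_sq _).const_mul _) ?_
    filter_upwards [𝒮.opH_ae_eq x, hK] with ζ h1 h2
    rw [h1]
    refine (Complex.re_le_norm _).trans ((norm_inner_matrixCLM_le h2 _ _).trans_eq ?_)
    ring
  rw [energyNorm, Real.sq_sqrt (le_trans (by positivity) hlow)]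
  exact ⟨hlow, hup⟩

/-! ### The Hautus test -/

/-- Integrating the derivative of `ζ ↦ ⟨(ℋx)(ζ), P₁ (ℋx)(ζ)⟩`, the energy flux, bounds
`|Re s| ‖x‖²` by boundary values, up to an error in `‖x‖²` caused by `G₀`. -/
theorem exists_energy_estimate (hW : IsUnit 𝒮.W_BC) :
    ∃ c K : ℝ, 0 < c ∧ 0 < K ∧ ∀ s : ℂ, s.re < 0 → ∀ x : 𝒮.A.domain,
      c * |s.re| ^ 2 * ‖(x : L2 n)‖ ^ 2 ≤
        K * (‖s • (x : L2 n) - 𝒮.A x‖ ^ 2 + |s.re| * ‖𝒮.C x‖ ^ 2 +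
          |s.re| * ‖(x : L2 n)‖ ^ 2) := by
  obtain ⟨Kh, hKh0, hKh⟩ := exists_norm_matrixCLM_le_of_memLp 𝒮.memLp_ℋ
  obtain ⟨Ki, hKi0, hKi⟩ := exists_norm_matrixCLM_le_of_memLp 𝒮.memLp_ℋ_inv
  obtain ⟨Kb, hKb0, hKb⟩ := 𝒮.exists_boundary_bound hW
  obtain ⟨Kp, hKp0, hKp⟩ : ∃ Kp, 0 < Kp ∧ ‖matrixCLM 𝒮.P₁‖ ≤ Kp :=
    ⟨_, lt_max_of_lt_left one_pos, le_max_right 1 _⟩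
  obtain ⟨Kg, hKg0, hKg⟩ : ∃ Kg, 0 < Kg ∧ ‖matrixCLM 𝒮.G₀‖ ≤ Kg :=
    ⟨_, lt_max_of_lt_left one_pos, le_max_right 1 _⟩
  obtain ⟨c, hc, hc0⟩ : ∃ c, c = Ki⁻¹ ∧ 0 < c := ⟨_, rfl, inv_pos.2 hKi0⟩
  refine ⟨c, 2 * Kp * Kb ^ 2 + Kh ^ 2 / c + 2 * Kg * Kh ^ 2, hc0, by positivity,
    fun s hs x => ?_⟩
  obtain ⟨v, w, hrep, hB, hC, hae⟩ := 𝒮.exists_isH1Rep x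
  obtain ⟨σ, hσ, hσ0⟩ : ∃ σ, σ = |s.re| ∧ 0 < σ := ⟨_, rfl, abs_pos.2 hs.ne⟩
  have hσ' : s.re = -σ := by rw [hσ, abs_of_neg hs, neg_neg]
  rw [← hσ]
  obtain ⟨z, hz⟩ : ∃ z, z = s • (x : L2 n) - 𝒮.A x := ⟨_, rfl⟩
  rw [← hz]
  obtain ⟨hb1, hb0⟩ := hKb _ _ hB
  rw [← hC] at hb1 hb0
  set φ : ℝ → ℝ := fun ζ => (inner ℂ (w ζ) (matrixCLM 𝒮.P₁ (w ζ))).re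
  have hconst : AbsolutelyContinuousOnInterval (fun _ : ℝ => matrixCLM 𝒮.P₁) 0 1 :=
    contDiffOn_const.absolutelyContinuousOnInterval
  have hac : AbsolutelyContinuousOnInterval φ 0 1 :=
    hrep.absCont.re_inner (hconst.clm_apply hrep.absCont)
  set g : ℝ → ℝ := fun ζ => (2 * Kg * Kh ^ 2 - σ * c) * ‖(x : L2 n) ζ‖ ^ 2 +
    Kh ^ 2 / (σ * c) * ‖z ζ‖ ^ 2 with hg
  have hi1 := (L2.integrable_norm_sq (x : L2 n)).const_mul (2 * Kg * Kh ^ 2 - σ * c)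
  have hi2 := (L2.integrable_norm_sq z).const_mul (Kh ^ 2 / (σ * c))
  have hgi : Integrable g unitMeasure := hi1.add hi2
  have hflux := hac.sub_le_integral hgi (by
    filter_upwards [hae, hKh, hKi, 𝒮.posDef_ℋ, coeFn_smul_sub s (x : L2 n) (𝒮.A x)]
      with ζ h1 h2 h3 h4 h5
    obtain ⟨hw, hwd, hA⟩ := h1
    rw [← hz] at h5
    refine ⟨2 * (inner ℂ (w ζ) (matrixCLM 𝒮.P₁ (v ζ))).re, ?_, ?_⟩
    · have hwd' : HasDerivAt (fun ζ => matrixCLM 𝒮.P₁ (w ζ)) (matrixCLM 𝒮.P₁ (v ζ)) ζ :=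
        ((matrixCLM 𝒮.P₁).restrictScalars ℝ).hasFDerivAt.comp_hasDerivAt ζ hwd
      have h6 := Complex.reCLM.hasFDerivAt.comp_hasDerivAt ζ (hwd.inner ℂ hwd')
      refine h6.congr_deriv ?_
      rw [Complex.reCLM_apply, Complex.add_re,
        ← inner_matrixCLM_of_isHermitian 𝒮.isHermitian_P₁ (v ζ),
        ← inner_conj_symm (matrixCLM 𝒮.P₁ (v ζ)), Complex.conj_re]
      ring
    · have h7 : matrixCLM 𝒮.P₁ (v ζ) = s • (x : L2 n) ζ - z ζ - matrixCLM 𝒮.G₀ (w ζ) := by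
        rw [h5, hA]
        abel
      have h8 : ‖w ζ‖ ≤ Kh * ‖(x : L2 n) ζ‖ := by
        rw [hw]
        exact ContinuousLinearMap.le_of_opNorm_le _ h2 _
      have h9 : (inner ℂ (w ζ) (s • (x : L2 n) ζ)).re =
          -σ * (inner ℂ (w ζ) ((x : L2 n) ζ)).re := by
        have : (inner ℂ (w ζ) ((x : L2 n) ζ)).im = 0 := by
          rw [hw]
          exact im_inner_matrixCLM_of_isHermitian h4.isHermitian _
        rw [inner_smul_right, Complex.mul_re, this, hσ']
        ring
      have h10 : c * ‖(x : L2 n) ζ‖ ^ 2 ≤ (inner ℂ (w ζ) ((x : L2 n) ζ)).re := by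
        rw [hw, hc]
        exact h4.inv_mul_norm_sq_le hKi0 h3 _
      have h11 : -(Kh * ‖(x : L2 n) ζ‖ * ‖z ζ‖) ≤ (inner ℂ (w ζ) (z ζ)).re := by
        refine neg_le_of_abs_le ((Complex.abs_re_le_norm _).trans
          ((norm_inner_le_norm _ _).trans ?_))
        gcongr
      have h12 : -(Kg * Kh ^ 2 * ‖(x : L2 n) ζ‖ ^ 2) ≤
          (inner ℂ (w ζ) (matrixCLM 𝒮.G₀ (w ζ))).re := by
        refine neg_le_of_abs_le ((Complex.abs_re_le_norm _).trans
          ((norm_inner_matrixCLM_le hKg _ _).trans ?_))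
        calc Kg * ‖w ζ‖ * ‖w ζ‖ ≤ Kg * (Kh * ‖(x : L2 n) ζ‖) * (Kh * ‖(x : L2 n) ζ‖) := by
              gcongr
          _ = _ := by ring
      rw [h7, inner_sub_right, inner_sub_right, Complex.sub_re, Complex.sub_re, h9]
      simp only [hg]
      -- Half of the gain `2 σ c ‖x‖²` absorbs the cross term `‖z‖ ‖x‖`.
      have h13 := two_mul_le_mul_sq_add (mul_pos hσ0 hc0) Kh ‖(x : L2 n) ζ‖ ‖z ζ‖
      have h14 := mul_le_mul_of_nonneg_left h10 hσ0.le
      linarith)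
    le_rfl zero_le_one le_rfl
  have hgint : ∫ ζ in (0 : ℝ)..1, g ζ =
      (2 * Kg * Kh ^ 2 - σ * c) * ‖(x : L2 n)‖ ^ 2 + Kh ^ 2 / (σ * c) * ‖z‖ ^ 2 := by
    rw [intervalIntegral.integral_of_le zero_le_one, ← integral_Icc_eq_integral_Ioc,
      L2.norm_sq_eq (x : L2 n), L2.norm_sq_eq z, ← integral_const_mul, ← integral_const_mul,
      ← integral_add hi1 hi2]
  have hφb : ∀ ζ, ‖w ζ‖ ≤ Kb * ‖𝒮.C x‖ → |φ ζ| ≤ Kp * Kb ^ 2 * ‖𝒮.C x‖ ^ 2 := fun ζ h => by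
    refine (Complex.abs_re_le_norm _).trans ((norm_inner_matrixCLM_le hKp _ _).trans ?_)
    calc Kp * ‖w ζ‖ * ‖w ζ‖ ≤ Kp * (Kb * ‖𝒮.C x‖) * (Kb * ‖𝒮.C x‖) := by gcongr
      _ = _ := by ring
  have hφ1 := neg_le_of_abs_le (hφb 1 hb1)
  have hφ0 := le_of_abs_le (hφb 0 hb0)
  rw [hgint] at hflux
  have hσc : Kh ^ 2 / (σ * c) * ‖z‖ ^ 2 = (Kh ^ 2 / c * ‖z‖ ^ 2) / σ := by
    field_simp
  rw [hσc] at hflux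
  have key : σ * (σ * c * ‖(x : L2 n)‖ ^ 2) ≤ σ * ((Kh ^ 2 / c * ‖z‖ ^ 2) / σ +
      2 * Kg * Kh ^ 2 * ‖(x : L2 n)‖ ^ 2 + 2 * Kp * Kb ^ 2 * ‖𝒮.C x‖ ^ 2) :=
    mul_le_mul_of_nonneg_left (by linarith) hσ0.le
  rw [mul_add, mul_add, mul_div_cancel₀ _ hσ0.ne'] at key
  have k1 : 0 ≤ 2 * Kp * Kb ^ 2 := by positivity
  have k2 : 0 ≤ Kh ^ 2 / c := by positivity
  have k3 : 0 ≤ 2 * Kg * Kh ^ 2 := by positivity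
  have e1 : 0 ≤ ‖z‖ ^ 2 := sq_nonneg _
  have e2 : 0 ≤ σ * ‖𝒮.C x‖ ^ 2 := mul_nonneg hσ0.le (sq_nonneg _)
  have e3 : 0 ≤ σ * ‖(x : L2 n)‖ ^ 2 := mul_nonneg hσ0.le (sq_nonneg _)
  calc c * σ ^ 2 * ‖(x : L2 n)‖ ^ 2 = σ * (σ * c * ‖(x : L2 n)‖ ^ 2) := by ring
    _ ≤ 2 * Kp * Kb ^ 2 * (σ * ‖𝒮.C x‖ ^ 2) + Kh ^ 2 / c * ‖z‖ ^ 2 +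
        2 * Kg * Kh ^ 2 * (σ * ‖(x : L2 n)‖ ^ 2) := by linarith
    _ ≤ 2 * Kp * Kb ^ 2 * (‖z‖ ^ 2 + σ * ‖𝒮.C x‖ ^ 2 + σ * ‖(x : L2 n)‖ ^ 2) +
        Kh ^ 2 / c * (‖z‖ ^ 2 + σ * ‖𝒮.C x‖ ^ 2 + σ * ‖(x : L2 n)‖ ^ 2) +
        2 * Kg * Kh ^ 2 * (‖z‖ ^ 2 + σ * ‖𝒮.C x‖ ^ 2 + σ * ‖(x : L2 n)‖ ^ 2) := by
      refine add_le_add (add_le_add (mul_le_mul_of_nonneg_left ?_ k1)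
        (mul_le_mul_of_nonneg_left ?_ k2)) (mul_le_mul_of_nonneg_left ?_ k3) <;> linarith
    _ = _ := by ring

/-- In the characteristic coordinates `y = F (ℋx)` with `F = S P₁`, where `P₁ ℋ = S⁻¹ Δ S`, the
derivative of `‖y‖²` is bounded by `‖y‖²` and `z`, uniformly in `s` with `|Re s| ≤ ρ`. -/
theorem exists_characteristic_coordinates {ρ : ℝ} (hρ : 0 ≤ ρ) :
    ∃ (F : ℝ → EuclideanSpace ℂ (Fin n) →L[ℂ] EuclideanSpace ℂ (Fin n)) (a Ks Kx : ℝ),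
      0 ≤ a ∧ 0 < Kx ∧ AbsolutelyContinuousOnInterval F 0 1 ∧
      ∀ᵐ ζ ∂unitMeasure, ∃ F', HasDerivAt F F' ζ ∧ ∀ s : ℂ, |s.re| ≤ ρ →
        ∀ x z v w : EuclideanSpace ℂ (Fin n), w = matrixCLM (𝒮.ℋ ζ) x →
          matrixCLM 𝒮.P₁ v = s • x - z - matrixCLM 𝒮.G₀ w →
          ‖x‖ ≤ Kx * ‖F ζ w‖ ∧
          2 * (inner ℂ (F ζ w) (F' w + F ζ v)).re ≤ a * ‖F ζ w‖ ^ 2 + Ks ^ 2 * ‖z‖ ^ 2 := by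
  obtain ⟨S, Δ, hS, hS1, hS2, hΔ⟩ := 𝒮.exists_diagonalization
  obtain ⟨Ki, hKi0, hKi⟩ := exists_norm_matrixCLM_le_of_memLp 𝒮.memLp_ℋ_inv
  have hbdd : ∀ f : ℝ → EuclideanSpace ℂ (Fin n) →L[ℂ] EuclideanSpace ℂ (Fin n),
      ContinuousOn f (Icc 0 1) → ∃ K, 0 < K ∧ ∀ ζ ∈ Icc (0 : ℝ) 1, ‖f ζ‖ ≤ K := fun f hf => by
    obtain ⟨K, hK⟩ := isCompact_Icc.exists_bound_of_continuousOn hf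
    exact ⟨max 1 K, lt_max_of_lt_left one_pos, fun ζ hζ => le_max_of_le_right (hK ζ hζ)⟩
  obtain ⟨Ks, hKs0, hKs⟩ := hbdd _ (contDiffOn_matrixCLM hS1).continuousOn
  obtain ⟨Kt, hKt0, hKt⟩ := hbdd _ (contDiffOn_matrixCLM hS2).continuousOn
  obtain ⟨Kd, hKd0, hKd⟩ := hbdd (fun ζ => matrixCLM (Matrix.diagonal (Δ ζ)))
    (contDiffOn_matrixCLM fun i j => by
      by_cases hij : i = j
      · subst hij
        simpa using hΔ i
      · simpa [Matrix.diagonal_apply_ne _ hij] using contDiffOn_const).continuousOn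
  have hFcd : ContDiffOn ℝ 1 (fun ζ => matrixCLM (S ζ * 𝒮.P₁)) (Icc 0 1) :=
    contDiffOn_matrixCLM fun i j => by
      simp only [Matrix.mul_apply]
      exact ContDiffOn.sum fun k _ => (hS1 i k).mul contDiffOn_const
  obtain ⟨Ke, hKe0, hKe⟩ := hbdd _ (hFcd.continuousOn_derivWithin (uniqueDiffOn_Icc zero_lt_one)
    le_rfl)
  obtain ⟨Kw, hKw, hKw0⟩ : ∃ Kw, Kw = ‖matrixCLM (𝒮.P₁)⁻¹‖ * Kt ∧ 0 ≤ Kw :=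
    ⟨_, rfl, mul_nonneg (norm_nonneg _) hKt0.le⟩
  have hKx0 : 0 ≤ Ki * Kw := mul_nonneg hKi0.le hKw0
  refine ⟨_, 2 * (ρ * (Kd * (Ks * (Ki * Kw + 1)) ^ 2)) + 2 * (Ke * Kw) +
    2 * (Ks * ‖matrixCLM 𝒮.G₀‖ * Kw) + 1, Ks, Ki * Kw + 1, by positivity, by positivity,
    ContDiffOn.absolutelyContinuousOnInterval (by rwa [uIcc_of_le zero_le_one]), ?_⟩
  have hmemIoo : ∀ᵐ ζ ∂unitMeasure, ζ ∈ Ioo (0 : ℝ) 1 := by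
    rw [unitMeasure, ← Measure.restrict_congr_set Ioo_ae_eq_Icc]
    exact ae_restrict_mem measurableSet_Ioo
  filter_upwards [hKi, hS, 𝒮.posDef_ℋ, hmemIoo] with ζ h2 h3 h4 h5
  have h5' := Ioo_subset_Icc_self h5
  refine ⟨derivWithin (fun ζ => matrixCLM (S ζ * 𝒮.P₁)) (Icc 0 1) ζ,
    ((hFcd.differentiableOn one_ne_zero ζ h5').hasDerivWithinAt).hasDerivAt
      (Icc_mem_nhds h5.1 h5.2), fun s hs x z v w hw hv => ?_⟩
  obtain ⟨y, hy⟩ : ∃ y, y = matrixCLM (S ζ * 𝒮.P₁) w := ⟨_, rfl⟩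
  have hwy : ‖w‖ ≤ Kw * ‖y‖ := by
    have h6 : w = matrixCLM (𝒮.P₁)⁻¹ (matrixCLM (S ζ)⁻¹ y) := by
      rw [hy, matrixCLM_mul_apply, matrixCLM_inv_apply h3.1, matrixCLM_inv_apply 𝒮.isUnit_P₁]
    conv_lhs => rw [h6]
    rw [hKw, mul_assoc]
    exact ContinuousLinearMap.le_opNorm_of_le _
      (ContinuousLinearMap.le_of_opNorm_le _ (hKt ζ h5') _)
  have hxy : ‖x‖ ≤ (Ki * Kw + 1) * ‖y‖ := by
    have h8 : x = matrixCLM (𝒮.ℋ ζ)⁻¹ w := by rw [hw, matrixCLM_inv_apply h4.isUnit]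
    calc ‖x‖ ≤ Ki * ‖w‖ := by
          rw [h8]
          exact ContinuousLinearMap.le_of_opNorm_le _ h2 _
      _ ≤ Ki * (Kw * ‖y‖) := mul_le_mul_of_nonneg_left hwy hKi0.le
      _ ≤ _ := by linarith [norm_nonneg y]
  rw [← hy]
  refine ⟨hxy, ?_⟩
  have := two_mul_re_inner_characteristic_le 𝒮.isHermitian_P₁ h4 h3.1 h3.2 hKd0.le hKe0.le
    (norm_nonneg _) hKs0.le (by positivity) (hKd ζ h5') (hKe ζ h5') le_rfl (hKs ζ h5') hs hw hv hy
    hwy hxy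
  exact this

/-- On a strip `|Re s| ≤ ρ`, a solution of `(s - A) x = z` is controlled by `z` and the output,
uniformly in `Im s`: in the characteristic coordinates Gronwall's inequality applies, started from
the boundary value at `0`. -/
theorem exists_strip_estimate (hW : IsUnit 𝒮.W_BC) {ρ : ℝ} (hρ : 0 ≤ ρ) :
    ∃ K : ℝ, 0 < K ∧ ∀ s : ℂ, |s.re| ≤ ρ → ∀ x : 𝒮.A.domain,
      ‖(x : L2 n)‖ ^ 2 ≤ K * (‖s • (x : L2 n) - 𝒮.A x‖ ^ 2 + ‖𝒮.C x‖ ^ 2) := by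
  obtain ⟨Kb, hKb0, hKb⟩ := 𝒮.exists_boundary_bound hW
  obtain ⟨F, a, Ks, Kx, ha0, hKx0, hFac, hF⟩ := 𝒮.exists_characteristic_coordinates hρ
  refine ⟨Kx ^ 2 * Real.exp a * (‖F 0‖ ^ 2 * Kb ^ 2 + Ks ^ 2 + 1), by positivity,
    fun s hs x => ?_⟩
  obtain ⟨v, w, hrep, hB, hC, hae⟩ := 𝒮.exists_isH1Rep x
  obtain ⟨z, hz⟩ : ∃ z, z = s • (x : L2 n) - 𝒮.A x := ⟨_, rfl⟩
  rw [← hz]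
  have hb0 := (hKb _ _ hB).2
  rw [← hC] at hb0
  have hyac : AbsolutelyContinuousOnInterval (fun ζ => F ζ (w ζ)) 0 1 :=
    hFac.clm_apply hrep.absCont
  set φ : ℝ → ℝ := fun ζ => (inner ℂ (F ζ (w ζ)) (F ζ (w ζ))).re
  have hφn : ∀ ζ, φ ζ = ‖F ζ (w ζ)‖ ^ 2 := fun ζ => inner_self_eq_norm_sq (𝕜 := ℂ) _
  have hac : AbsolutelyContinuousOnInterval φ 0 1 := hyac.re_inner hyac
  have hmain : ∀ᵐ ζ ∂unitMeasure, ‖(x : L2 n) ζ‖ ≤ Kx * ‖F ζ (w ζ)‖ ∧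
      ∃ d, HasDerivAt φ d ζ ∧ d ≤ a * φ ζ + Ks ^ 2 * ‖z ζ‖ ^ 2 := by
    filter_upwards [hae, hF, coeFn_smul_sub s (x : L2 n) (𝒮.A x)] with ζ h1 h2 h6
    obtain ⟨hw, hwd, hA⟩ := h1
    obtain ⟨F', hFd, h2⟩ := h2
    rw [← hz] at h6
    have hyd : HasDerivAt (fun ζ => F ζ (w ζ)) (F' (w ζ) + F ζ (v ζ)) ζ := by
      have hFd' := (ContinuousLinearMap.restrictScalarsL ℂ (EuclideanSpace ℂ (Fin n))
        (EuclideanSpace ℂ (Fin n)) ℝ ℝ).hasFDerivAt.comp_hasDerivAt ζ hFd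
      exact hFd'.clm_apply hwd
    have h7 := h2 s hs _ (z ζ) (v ζ) _ hw (by
      rw [h6, hA]
      abel)
    refine ⟨h7.1, _, hasDerivAt_norm_sq hyd, ?_⟩
    rw [hφn]
    exact h7.2
  have hgi := (L2.integrable_norm_sq z).const_mul (Ks ^ 2)
  have hgron : ∀ ζ ∈ Icc (0 : ℝ) 1,
      φ ζ ≤ Real.exp (a * ζ) * (φ 0 + ∫ ζ, Ks ^ 2 * ‖z ζ‖ ^ 2 ∂unitMeasure) := fun ζ hζ =>
    hac.le_exp_mul ha0 hgi (fun ζ => by positivity) (hmain.mono fun ζ h => h.2) hζ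
  have hφ0 : φ 0 ≤ ‖F 0‖ ^ 2 * Kb ^ 2 * ‖𝒮.C x‖ ^ 2 := by
    rw [hφn, ← mul_pow, ← mul_pow, mul_assoc]
    gcongr
    exact ContinuousLinearMap.le_opNorm_of_le _ hb0
  rw [integral_const_mul, ← L2.norm_sq_eq] at hgron
  have hprob : IsProbabilityMeasure unitMeasure := ⟨by simp⟩
  obtain ⟨D, hD⟩ : ∃ D, D = ‖F 0‖ ^ 2 * Kb ^ 2 * ‖𝒮.C x‖ ^ 2 + Ks ^ 2 * ‖z‖ ^ 2 := ⟨_, rfl⟩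
  have hD0 : 0 ≤ D := by rw [hD]; positivity
  have hfin : ‖(x : L2 n)‖ ^ 2 ≤ ∫ _, Kx ^ 2 * (Real.exp a * D) ∂unitMeasure := by
    refine L2.norm_sq_le_of_ae_le (integrable_const _) ?_
    have hmem : ∀ᵐ ζ ∂unitMeasure, ζ ∈ Icc (0 : ℝ) 1 := ae_restrict_mem measurableSet_Icc
    filter_upwards [hmain, hmem] with ζ h1 h2
    calc ‖(x : L2 n) ζ‖ ^ 2 ≤ (Kx * ‖F ζ (w ζ)‖) ^ 2 := by
          gcongr
          exact h1.1
      _ = Kx ^ 2 * φ ζ := by rw [mul_pow, hφn]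
      _ ≤ Kx ^ 2 * (Real.exp (a * ζ) * (φ 0 + Ks ^ 2 * ‖z‖ ^ 2)) := by
          gcongr
          exact hgron ζ h2
      _ ≤ Kx ^ 2 * (Real.exp (a * ζ) * D) := by
          rw [hD]
          gcongr
      _ ≤ _ := by
          gcongr
          exact mul_le_of_le_one_right ha0 h2.2
  rw [integral_const, probReal_univ, one_smul] at hfin
  refine hfin.trans ?_
  rw [← mul_assoc, mul_assoc _ _ (‖z‖ ^ 2 + _)]
  gcongr
  have e1 : 0 ≤ ‖F 0‖ ^ 2 * Kb ^ 2 * ‖z‖ ^ 2 := by positivity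
  have e2 : 0 ≤ Ks ^ 2 * ‖𝒮.C x‖ ^ 2 := by positivity
  linarith [sq_nonneg ‖z‖, sq_nonneg ‖𝒮.C x‖]

/-- The Hautus test in the norm of `L²(0, 1; ℂⁿ)`. The open left half plane is covered by three
vertical regions, with the energy estimate for large `|Re s|`, the resolvent bound of the stable
semigroup for small `|Re s|`, and the strip estimate in between. -/
theorem hautusTest_norm (hW : IsUnit 𝒮.W_BC) {T : C0Semigroup (L2 n)} (hT : T.Generates 𝒮.A)
    (hexp : T.ExponentiallyStable) : HautusTest (fun x : L2 n => ‖x‖) 𝒮.A 𝒮.C := by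
  obtain ⟨M, ω, hM1, hω, hTb⟩ := hexp
  have hM : 0 < M := zero_lt_one.trans_le hM1
  obtain ⟨c, K, hc, hK, hE⟩ := 𝒮.exists_energy_estimate hW
  -- For `|Re s| ≥ ρ` the error term `K |Re s| ‖x‖²` is at most half of `c |Re s|² ‖x‖²`.
  obtain ⟨ρ, hρ⟩ : ∃ ρ, ρ = 2 * K / c := ⟨_, rfl⟩
  have hρ0 : 0 < ρ := by rw [hρ]; positivity
  obtain ⟨L, hL, hS⟩ := 𝒮.exists_strip_estimate hW hρ0.le
  obtain ⟨δ, hδ, hδ0⟩ : ∃ δ, δ = ω / 2 ∧ 0 < δ := ⟨_, rfl, half_pos hω⟩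
  obtain ⟨m₁, hm₁, hm₁0⟩ : ∃ m, m = c / (2 * K) ∧ 0 < m := ⟨_, rfl, by positivity⟩
  obtain ⟨m₂, hm₂, hm₂0⟩ : ∃ m, m = min 1 δ / (L * ρ ^ 2) ∧ 0 < m :=
    ⟨_, rfl, div_pos (lt_min one_pos hδ0) (by positivity)⟩
  obtain ⟨m₃, hm₃, hm₃0⟩ : ∃ m, m = 1 / M ^ 2 ∧ 0 < m := ⟨_, rfl, by positivity⟩
  refine ⟨min m₁ (min m₂ m₃), lt_min hm₁0 (lt_min hm₂0 hm₃0), fun s hs x => ?_⟩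
  have hEx := hE s hs x
  have hSx : |s.re| ≤ ρ → _ := fun h => hS s h x
  have hRx : |s.re| ≤ δ → ‖(x : L2 n)‖ ^ 2 ≤ (M / δ) ^ 2 * ‖s • (x : L2 n) - 𝒮.A x‖ ^ 2 :=
    fun h => by
    rw [abs_of_neg hs] at h
    rw [← mul_pow]
    exact pow_le_pow_left₀ (norm_nonneg _) (C0Semigroup.norm_le_of_hasGenerator hM.le hTb hδ0
      (by linarith) (hT.hasGenerator x) (by linarith)) 2
  have hσ0 : 0 < |s.re| := abs_pos.2 hs.ne
  have hX : 0 ≤ ‖(x : L2 n)‖ ^ 2 := sq_nonneg _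
  have hZ : 0 ≤ ‖s • (x : L2 n) - 𝒮.A x‖ ^ 2 := sq_nonneg _
  have hY : 0 ≤ ‖𝒮.C x‖ ^ 2 := sq_nonneg _
  beta_reduce
  clear hE hS hTb
  revert hEx hSx hRx hσ0 hX hZ hY
  generalize |s.re| = σ
  generalize ‖(x : L2 n)‖ ^ 2 = X
  generalize ‖s • (x : L2 n) - 𝒮.A x‖ ^ 2 = Z
  generalize ‖𝒮.C x‖ ^ 2 = Y
  intro hEx hSx hRx hσ0 hX hZ hY
  have hσX : 0 ≤ σ ^ 2 * X := by positivity
  have hσY : 0 ≤ σ * Y := by positivity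
  rw [mul_assoc]
  rcases le_total ρ σ with h1 | h1
  · refine (mul_le_mul_of_nonneg_right (min_le_left _ _) hσX).trans ?_
    have h2 : 2 * K ≤ c * σ := by
      rw [hρ, div_le_iff₀ hc] at h1
      linarith
    have h3 : 2 * K * (σ * X) ≤ c * σ * (σ * X) := mul_le_mul_of_nonneg_right h2 (by positivity)
    rw [hm₁, div_mul_eq_mul_div, div_le_iff₀ (by positivity)]
    linarith
  · rcases le_total δ σ with h2 | h2
    · refine (mul_le_mul_of_nonneg_right ((min_le_right _ _).trans (min_le_left _ _)) hσX).trans ?_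
      have h3 : σ ^ 2 * X ≤ ρ ^ 2 * (L * (Z + Y)) := by
        gcongr
        exact hSx h1
      have h4 : min 1 δ * Z ≤ 1 * Z := mul_le_mul_of_nonneg_right (min_le_left _ _) hZ
      have h5 : min 1 δ * Y ≤ σ * Y := mul_le_mul_of_nonneg_right ((min_le_right _ _).trans h2) hY
      calc m₂ * (σ ^ 2 * X) ≤ m₂ * (ρ ^ 2 * (L * (Z + Y))) := by gcongr
        _ = min 1 δ * Z + min 1 δ * Y := by
          rw [hm₂]
          field_simp
        _ ≤ _ := by linarith
    · refine (mul_le_mul_of_nonneg_right ((min_le_right _ _).trans (min_le_right _ _)) hσX).trans ?_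
      have h3 : σ ^ 2 * X ≤ δ ^ 2 * ((M / δ) ^ 2 * Z) := by
        gcongr
        exact hRx h2
      calc m₃ * (σ ^ 2 * X) ≤ m₃ * (δ ^ 2 * ((M / δ) ^ 2 * Z)) := by gcongr
        _ = Z := by
          rw [hm₃]
          field_simp
        _ ≤ _ := by linarith

/-- The Hautus test is invariant under passing to the equivalent energy norm. -/
theorem hautusTest_energyNorm (h : HautusTest (fun x : L2 n => ‖x‖) 𝒮.A 𝒮.C) :
    HautusTest 𝒮.energyNorm 𝒮.A 𝒮.C := by
  obtain ⟨m, hm, h⟩ := h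
  obtain ⟨a, b, ha, hb, hab⟩ := 𝒮.exists_energyNorm_bounds
  refine ⟨min 1 a * (m / b), by positivity, fun s hs x => ?_⟩
  have h1 := h s hs x
  have h2 := (hab x).2
  have h3 := (hab (s • (x : L2 n) - 𝒮.A x)).1
  have hσ0 : 0 ≤ |s.re| := abs_nonneg _
  have hZ : 0 ≤ ‖s • (x : L2 n) - 𝒮.A x‖ ^ 2 := sq_nonneg _
  have hY : 0 ≤ |s.re| * ‖𝒮.C x‖ ^ 2 := mul_nonneg hσ0 (sq_nonneg _)
  have h4 := mul_le_mul_of_nonneg_right (min_le_left 1 a) hY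
  have h5 := mul_le_mul_of_nonneg_right (min_le_right 1 a) hZ
  calc min 1 a * (m / b) * |s.re| ^ 2 * 𝒮.energyNorm x ^ 2
      ≤ min 1 a * (m / b) * |s.re| ^ 2 * (b * ‖(x : L2 n)‖ ^ 2) := by gcongr
    _ = min 1 a * (m * |s.re| ^ 2 * ‖(x : L2 n)‖ ^ 2) := by field_simp
    _ ≤ min 1 a * (‖s • (x : L2 n) - 𝒮.A x‖ ^ 2 + |s.re| * ‖𝒮.C x‖ ^ 2) := by gcongr
    _ ≤ _ := by linarith

end PortHamiltonianSystem

theorem theorem3p4 {n : ℕ} (𝒮 : PortHamiltonianSystem n)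
    (T : C0Semigroup (L2 n)) (hT : T.Generates 𝒮.A)
    (hW : IsUnit 𝒮.W_BC)
    (hexp : T.ExponentiallyStable)
    (T₀ : C0Semigroup (L2 n)) (hT₀ : T₀.Generates 𝒮.ASubReG₀H)
    (hstrong : T₀.StronglyStable) :
    HautusTest 𝒮.energyNorm 𝒮.A 𝒮.C ∧ ApproximatelyObservable T hT 𝒮.C := by
  have hH := 𝒮.hautusTest_norm hW hT hexp
  obtain ⟨K, hK⟩ := 𝒮.exists_norm_C_le
  exact ⟨𝒮.hautusTest_energyNorm hH,
    C0Semigroup.approximatelyObservable_of_hautusTest hT hexp 𝒮.C hK hH⟩
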